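/- Let $d,d'\ge 0$ be integers, let $Y\subseteq\mathbb R^{d'}$ be nonempty, closed and convex, let $f:\mathbb R^d\times Y\to\mathbb R$ have partial gradients $\nabla_x f,\nabla_y f$, and let $0<\rho\le\ell$, $L\ge 0$, $\mu,\mu_x,\mu_y>0$, $\sigma\ge 0$, $\varepsilon_0\ge 0$. Write $P(x)=\max_{y\in Y}f(x,y)$ and $\mathrm{Gap}(x,y)=\max_{y'\in Y}f(x,y')-\min_{x'\in\mathbb R^d}f(x',y)$. A differentiable function $h$ on $\mathbb R^d$ is called $\nu$-PL if it has a global minimum point $x_*$ and $\|\nabla h(x)\|^2\ge 2\nu\,(h(x)-h(x_*))$ for all $x$. Assume: (a) $F=(\nabla_x f,-\nabla_y f)$ is $\ell$-Lipschitz on $\mathbb R^d\times Y$ (Euclidean norm); (b) $f(x,\cdot)$ is $\mu_y$-strongly concave on $Y$ for every $x$; (c) $P$ is differentiable with $L$-Lipschitz gradient and is $\mu$-PL (if $P$ is constant, so that this holds for every $\mu$, assume also $\mu\le L+2\rho$); (d) $f(\cdot,y)$ is $\rho$-weakly convex for every $y\in Y$, that is, $\langle\nabla_x f(x',y),x-x'\rangle-\frac{\rho}{2}\|x-x'\|^2\le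 f(x,y)-f(x',y)$ for all $x,x'$; (e) $f(\cdot,y)$ is $\mu_x$-PL for every $y\in Y$; (f) for a random variable $\xi$ there are stochastic gradients $\nabla_x f(x,y;\xi)$, $\nabla_y f(x,y;\xi)$, measurable in $(x,y,\xi)$, which for all $x\in\mathbb R^d$, $y\in Y$ have means $\nabla_x f(x,y)$, $\nabla_y f(x,y)$ and satisfy $\mathbb E\|\nabla_x f(x,y;\xi)-\nabla_x f(x,y)\|^2\le\sigma^2$ and $\mathbb E\|\nabla_y f(x,y;\xi)-\nabla_y f(x,y)\|^2\le\sigma^2$; (g) the starting point $(x_0,y_0)\in\mathbb R^d\times Y$ satisfies $\mathrm{Gap}(x_0,y_0)\le\varepsilon_0$. Algorithm (proximal epoch stochastic method with optimistic gradient descent ascent). Let $\gamma=2\rho$, $c=4\rho+\frac{248}{53}(L+2\rho)$, and for $k\ge1$ $$\eta_k=\eta_0\,e^{-(k-1)\frac{2\mu}{c+2\mu}},\qquad T_k=\Big\lceil \frac{212}{\eta_0\min\{\rho,\mu_y\}}\,e^{(k-1)\frac{2\mu}{c+2\mu}}\Big\rceil .$$ In stage $k=1,2,\dots$ put $z_0=\tilde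 z_0=(x_{k-1},y_{k-1})$ and, for $t=1,\dots,T_k$, $$z_t=\Pi_{\tilde z_{t-1}}\big(\eta_k\,\mathcal G_k(z_{t-1};\xi^k_{t-1})\big),\qquad \tilde z_t=\Pi_{\tilde z_{t-1}}\big(\eta_k\,\mathcal G_k(z_t;\xi^k_t)\big),$$ where $\mathcal G_k(z;\xi)=\big(\nabla_x f(x,y;\xi)+\gamma(x-x_{k-1}),\,-\nabla_y f(x,y;\xi)\big)$ for $z=(x,y)$, $\Pi_{\bar z}(g)=\arg\min_{z\in\mathbb R^d\times Y}\{g^\top z+\frac12\|z-\bar z\|^2\}$, and all the $\xi^k_t$ are independent copies of $\xi$. Then put $(x_k,y_k)=\frac1{T_k}\sum_{t=1}^{T_k}z_t$. Claim. There are universal constants $\theta\in(0,\frac1{2\sqrt2}]$, $C>0$ and $p\in\mathbb N$ such that, with $\eta_0=\theta/\ell$ (so that $\eta_k\le\frac{1}{2\sqrt2\,\ell}$ for all $k\ge1$), the following holds. For every $\varepsilon>0$ there is a number of stages $K_0$, depending only on $\ell,L,\rho,\mu,\mu_x,\mu_y,\sigma,\varepsilon_0,\varepsilon$, such that $\mathrm{Gap}(x_K,y_K)$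 is integrable and $$\mathbb E[\mathrm{Gap}(x_K,y_K)]\le\varepsilon\qquad\text{for all }K\ge K_0,$$ and the total number of iterations of the first $K_0$ stages satisfies $$\sum_{k=1}^{K_0}T_k\le C\,M\,\log^p(2+M),\qquad M=\Big(\frac{\rho}{\mu_x}+1\Big)\max\Big\{\frac{\ell(L+\rho)\varepsilon_0}{\mu\min\{\rho,\mu_y\}\varepsilon},\ \frac{(L+\rho)^2\sigma^2}{\mu^2\min\{\rho,\mu_y\}\varepsilon}\Big\},$$ that is, it is $\widetilde O(M)$. -/

import Mathlib

open MeasureTheory ProbabilityTheory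

noncomputable section

namespace PES

/-- The Euclidean space `ℝ^n`. -/
abbrev E (n : ℕ) : Type := EuclideanSpace ℝ (Fin n)

/-! ### Functions -/

/-- `h` is `L`-smooth on `ℝ^n`: differentiable with `L`-Lipschitz gradient. -/
def IsSmooth {n : ℕ} (L : ℝ) (h : E n → ℝ) : Prop :=
  Differentiable ℝ h ∧ ∀ x x' : E n, ‖gradient h x - gradient h x'‖ ≤ L * ‖x - x'‖

/-- `h` satisfies the `μ`-PL condition on `ℝ^n`: it has a global minimum point `xs`, and
`‖∇h(x)‖² ≥ 2 μ (h(x) - h(xs))` for all `x`. -/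
def SatisfiesPL {n : ℕ} (μ : ℝ) (h : E n → ℝ) : Prop :=
  ∃ xs : E n, (∀ x, h xs ≤ h x) ∧ ∀ x, 2 * μ * (h x - h xs) ≤ ‖gradient h x‖ ^ 2

/-- `h` is differentiable and `ρ`-weakly convex on `ℝ^n`. -/
def IsWeaklyConvex {n : ℕ} (ρ : ℝ) (h : E n → ℝ) : Prop :=
  Differentiable ℝ h ∧
    ∀ x x' : E n, inner ℝ (gradient h x') (x - x') - ρ / 2 * ‖x - x'‖ ^ 2 ≤ h x - h x'

/-! ### The min-max problem `min_{x ∈ ℝ^d} max_{y ∈ Y} f(x, y)` -/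

/-- The partial gradient `∇ₓ f(x, y)`. -/
def gradX {d d' : ℕ} (f : E d → E d' → ℝ) (x : E d) (y : E d') : E d :=
  gradient (fun u => f u y) x

/-- The primal function `P(x) = max_{y ∈ Y} f(x, y)`. -/
def primal {d d' : ℕ} (Y : Set (E d')) (f : E d → E d' → ℝ) (x : E d) : ℝ :=
  ⨆ y : Y, f x y

/-- The duality gap `Gap(x, y) = max_{y' ∈ Y} f(x, y') - min_{x' ∈ ℝ^d} f(x', y)`. -/
def gap {d d' : ℕ} (Y : Set (E d')) (f : E d → E d' → ℝ) (x : E d) (y : E d') : ℝ :=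
  (⨆ y' : Y, f x y') - ⨅ x' : E d, f x' y

/-- The assumptions on the min-max problem. Only the values of `f x y` with `y ∈ Y` matter.
`gy x y` is the partial gradient `∇_y f(x, y)` for `y ∈ Y`; it is taken within `Y`, so that `f`
need not be defined outside of `ℝ^d × Y`. -/
structure IsMinMaxProblem {d d' : ℕ} (Y : Set (E d')) (f : E d → E d' → ℝ)
    (gy : E d → E d' → E d') (ℓ L ρ μ μx μy : ℝ) : Prop where
  nonempty : Y.Nonempty
  closed : IsClosed Y
  convex : Convex ℝ Y
  /-- `gy` is the partial gradient in `y`. -/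
  hasGrad : ∀ x, ∀ y ∈ Y, HasGradientWithinAt (f x) (gy x y) Y y
  /-- `F = (∇ₓ f, -∇_y f)` is `ℓ`-Lipschitz on `ℝ^d × Y` for the Euclidean norm. -/
  lipschitz : ∀ x x', ∀ y ∈ Y, ∀ y' ∈ Y,
    ‖gradX f x y - gradX f x' y'‖ ^ 2 + ‖gy x y - gy x' y'‖ ^ 2
      ≤ ℓ ^ 2 * (‖x - x'‖ ^ 2 + ‖y - y'‖ ^ 2)
  /-- `f` is `μy`-strongly concave in `y`. -/
  strongConcave : ∀ x, StrongConcaveOn Y μy (f x)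
  /-- The primal function is `L`-smooth. -/
  smooth : IsSmooth L (primal Y f)
  /-- The primal function has a minimum point and satisfies the `μ`-PL condition. -/
  primalPL : SatisfiesPL μ (primal Y f)
  /-- `f` is differentiable and `ρ`-weakly convex in `x`. -/
  weaklyConvex : ∀ y ∈ Y, IsWeaklyConvex ρ (fun x => f x y)
  /-- `f` satisfies the `x`-side `μx`-PL condition. -/
  xPL : ∀ y ∈ Y, SatisfiesPL μx (fun x => f x y)
  /-- If the primal function is constant, then it is `μ`-PL for every `μ`, and `μ` is chosen at
  most `L + 2 ρ`. (If it is not constant, smoothness and the PL condition imply `μ ≤ L`.) -/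
  const : (∀ x x', primal Y f x = primal Y f x') → μ ≤ L + 2 * ρ

/-- `(Gx, Gy)` with `ξ ∼ ν` is an unbiased stochastic oracle for `(∇ₓ f, ∇_y f)` on `ℝ^d × Y`
such that both variances are at most `σ²`. -/
structure IsStochGrad {d d' : ℕ} {Ξ : Type*} [MeasurableSpace Ξ] (Y : Set (E d'))
    (f : E d → E d' → ℝ) (gy : E d → E d' → E d') (ν : Measure Ξ)
    (Gx : E d → E d' → Ξ → E d) (Gy : E d → E d' → Ξ → E d') (σ : ℝ) : Prop where
  measurable_x : Measurable fun p : (E d × E d') × Ξ => Gx p.1.1 p.1.2 p.2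
  measurable_y : Measurable fun p : (E d × E d') × Ξ => Gy p.1.1 p.1.2 p.2
  integrable_x : ∀ x, ∀ y ∈ Y, Integrable (Gx x y) ν
  integrable_y : ∀ x, ∀ y ∈ Y, Integrable (Gy x y) ν
  mean_x : ∀ x, ∀ y ∈ Y, ∫ s, Gx x y s ∂ν = gradX f x y
  mean_y : ∀ x, ∀ y ∈ Y, ∫ s, Gy x y s ∂ν = gy x y
  integrable_var_x : ∀ x, ∀ y ∈ Y, Integrable (fun s => ‖Gx x y s - gradX f x y‖ ^ 2) ν
  integrable_var_y : ∀ x, ∀ y ∈ Y, Integrable (fun s => ‖Gy x y s - gy x y‖ ^ 2) ν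
  var_x : ∀ x, ∀ y ∈ Y, ∫ s, ‖Gx x y s - gradX f x y‖ ^ 2 ∂ν ≤ σ ^ 2
  var_y : ∀ x, ∀ y ∈ Y, ∫ s, ‖Gy x y s - gy x y‖ ^ 2 ∂ν ≤ σ ^ 2

/-! ### The algorithm -/

/-- The function minimized in a proximal step from `zb` along `g`:
`z ↦ gᵀ z + ‖z - zb‖² / 2` (Euclidean norm of `ℝ^(d+d')`). -/
def proxObj {d d' : ℕ} (zb g z : E d × E d') : ℝ :=
  inner ℝ g.1 z.1 + inner ℝ g.2 z.2 + (‖z.1 - zb.1‖ ^ 2 + ‖z.2 - zb.2‖ ^ 2) / 2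

/-- `Π_zb(g) = argmin_{z ∈ ℝ^d × Y} gᵀ z + ‖z - zb‖² / 2`. -/
def prox {d d' : ℕ} (Y : Set (E d')) (zb g : E d × E d') : E d × E d' :=
  Classical.epsilon fun z => z.2 ∈ Y ∧ ∀ w : E d × E d', w.2 ∈ Y → proxObj zb g z ≤ proxObj zb g w

/-- The pairs `(z_t, z̃_t)` of the stochastic OGDA method started at `z0`, with step size `η`,
stochastic gradient field `G` (for `(∇ₓ, -∇_y)`) and samples `s 0, s 1, …`:
`z_t = Π_{z̃_{t-1}}(η G(z_{t-1}; s_{t-1}))`, `z̃_t = Π_{z̃_{t-1}}(η G(z_t; s_t))`. -/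
def ogdaState {d d' : ℕ} {Ξ : Type*} (Y : Set (E d')) (G : E d × E d' → Ξ → E d × E d')
    (s : ℕ → Ξ) (η : ℝ) (z0 : E d × E d') : ℕ → (E d × E d') × (E d × E d')
  | 0 => (z0, z0)
  | t + 1 =>
    let p := ogdaState Y G s η z0 t
    let z := prox Y p.2 (η • G p.1 (s t))
    (z, prox Y p.2 (η • G z (s (t + 1))))

/-- The output `(1/T) ∑_{t=1}^T z_t` of `T` iterations of stochastic OGDA. -/
def ogda {d d' : ℕ} {Ξ : Type*} (Y : Set (E d')) (G : E d × E d' → Ξ → E d × E d')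
    (s : ℕ → Ξ) (η : ℝ) (T : ℕ) (z0 : E d × E d') : E d × E d' :=
  (T : ℝ)⁻¹ • ∑ t ∈ Finset.Icc 1 T, (ogdaState Y G s η z0 t).1

/-- The stochastic gradient field, for `(∇ₓ, -∇_y)`, of the regularized function
`f(x, y) + (γ / 2) ‖x - xr‖²` with reference point `xr`. -/
def regField {d d' : ℕ} {Ξ : Type*} (Gx : E d → E d' → Ξ → E d) (Gy : E d → E d' → Ξ → E d')
    (γ : ℝ) (xr : E d) (z : E d × E d') (ξ : Ξ) : E d × E d' :=
  (Gx z.1 z.2 ξ + γ • (z.1 - xr), -Gy z.1 z.2 ξ)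

/-- The iterates `(x_k, y_k)` of the proximal epoch stochastic method with OGDA updates: stage
`k ≥ 1` runs `T k` iterations of OGDA with step size `η k` and samples `s k 0, s k 1, …`, from
`(x_{k-1}, y_{k-1})`, on `f(x, y) + (γ / 2) ‖x - x_{k-1}‖²`. -/
def pes {d d' : ℕ} {Ξ : Type*} (Y : Set (E d')) (Gx : E d → E d' → Ξ → E d)
    (Gy : E d → E d' → Ξ → E d') (γ : ℝ) (η : ℕ → ℝ) (T : ℕ → ℕ) (z0 : E d × E d')
    (s : ℕ → ℕ → Ξ) : ℕ → E d × E d'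
  | 0 => z0
  | k + 1 =>
    let z := pes Y Gx Gy γ η T z0 s k
    ogda Y (regField Gx Gy γ z.1) (s (k + 1)) (η (k + 1)) (T (k + 1)) z

/-! ### The parameters -/

/-- `c = 4 ρ + (248/53) L̂` with `L̂ = L + 2 ρ`. -/
def cConst (L ρ : ℝ) : ℝ := 4 * ρ + 248 / 53 * (L + 2 * ρ)

/-- The step sizes `η_k = η₀ exp(-(k-1) 2μ/(c+2μ))`, `k ≥ 1`. -/
def stepSize (η₀ L ρ μ : ℝ) (k : ℕ) : ℝ :=
  η₀ * Real.exp (-((k : ℝ) - 1) * (2 * μ / (cConst L ρ + 2 * μ)))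

/-- The epoch lengths `T_k = 212/(η₀ min{ρ, μ_y}) exp((k-1) 2μ/(c+2μ))`, `k ≥ 1`, rounded up. -/
def epochLength (η₀ L ρ μ μy : ℝ) (k : ℕ) : ℕ :=
  ⌈212 / (η₀ * min ρ μy) * Real.exp (((k : ℝ) - 1) * (2 * μ / (cConst L ρ + 2 * μ)))⌉₊

/-- The complexity
`(ρ/μ_x+1) max{ℓ(L+ρ)ε₀/(μ min{ρ,μ_y} ε), (L+ρ)²σ²/(μ² min{ρ,μ_y} ε)}`. -/
def complexity (ℓ L ρ μ μx μy σ ε₀ ε : ℝ) : ℝ :=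
  (ρ / μx + 1) * max (ℓ * (L + ρ) * ε₀ / (μ * min ρ μy * ε))
    ((L + ρ) ^ 2 * σ ^ 2 / (μ ^ 2 * min ρ μy * ε))

/-- The random iterate `z_K = (x_K, y_K)` of the proximal epoch stochastic method with OGDA updates
for the above step sizes and epoch lengths, regularization `γ = 2 ρ` and samples `ξ k t`. -/
def iterate {d d' : ℕ} {Ω Ξ : Type*} (Y : Set (E d')) (Gx : E d → E d' → Ξ → E d)
    (Gy : E d → E d' → Ξ → E d') (ξ : ℕ → ℕ → Ω → Ξ) (η₀ L ρ μ μy : ℝ) (z0 : E d × E d') (K : ℕ)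
    (ω : Ω) : E d × E d' :=
  pes Y Gx Gy (2 * ρ) (stepSize η₀ L ρ μ) (epochLength η₀ L ρ μ μy) z0 (fun k t => ξ k t ω) K

end PES

end

/-!
Stage `k` runs stochastic optimistic gradient descent ascent on the regularized function
`f(x, y) + ρ ‖x - r‖²`, `r = x_{k-1}`, which is `ρ`-strongly convex in `x` and `μ_y`-strongly
concave in `y`. Its duality gap is `regGap r x y`; write `D` and `G` for its values at the start and
at the output of the stage, and `p` for the primal suboptimality `P(x_k) - min P`.

*One stage.* The three-point inequality of the proximal steps gives a pathwise regret bound against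
every comparison point (`optimistic_regret_mean`), in which the auxiliary sequence `z₀ + η ∑ nₛ`
decouples the comparison point, which may depend on the samples, from the noise. Compared with the
best responses to the output, whose distances to the starting point are at most a multiple of
`D + G` by strong convexity (`exists_best_responses`), this bounds `G` by `(D + G) / 106` and a
stochastic error. The error is the sum of squares of the noise and of cross terms whose mean is
zero, since a sample is independent of everything that was computed before it
(`integral_inner_noise`, `integral_residual_le`). Hence `E G ≤ E D / 105 + 14 η σ²`
(`integral_regGap_ogda_le`).

*From stage to stage.* The output of a stage is an inexact proximal point step for the primal
function. The PL condition and smoothness yield a decrease of `p` (`primal_decrease`), and the gap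
of the next stage at its starting point is at most a multiple of `G` and of the decrease of `p`
(`regGap_self_le`). A combination of `p` and `D` therefore contracts by the factor `c / (c + 2μ)`,
which is `1 - α` with `α = 2μ / (c + 2μ)`; as the step sizes decay at the rate `α` too, after `k`
stages the potential is of order `exp (-α k) (ε₀ + k σ² / ℓ)` (`stage_recursion`).

*The duality gap.* The PL condition in `x` bounds the gap of `f` by `ρ / μ_x + 1` times the
regularized gaps of the last stage (`gap_le`, `integral_gap_iterate_le`). It remains to choose the
number of stages: the epoch lengths form a geometric series, which the last epochs dominate, so
the cost is of order `exp (α K₀) ℓ / (α min{ρ, μ_y})` (`sum_epochLength_le`), and the factor `k` in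
the noise costs one logarithm (`exists_stages`). If `μ > L + 2ρ`, then no problem satisfies the
assumptions (`mu_le`).
-/

noncomputable section

namespace PES

/-! ### Smooth functions and strongly concave functions -/

section

variable {n : ℕ}

theorem IsSmooth.le_add_inner {L : ℝ} {h : E n → ℝ} (hh : IsSmooth L h) (x y : E n) :
    h y ≤ h x + inner ℝ (gradient h x) (y - x) + L / 2 * ‖y - x‖ ^ 2 := by
  set v := y - x with hv
  have hd : ∀ t : ℝ, HasDerivAt (fun t : ℝ => h (x + t • v) - t * inner ℝ (gradient h x) v
      - L / 2 * ‖v‖ ^ 2 * t ^ 2)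
      (inner ℝ (gradient h (x + t • v)) v - inner ℝ (gradient h x) v
        - L / 2 * ‖v‖ ^ 2 * (2 * t)) t := by
    intro t
    have h1 : HasFDerivAt h (fderiv ℝ h (x + t • v)) (x + t • v) :=
      (hh.1 _).hasFDerivAt
    have h2 : HasDerivAt (fun t : ℝ => x + t • v) v t := by
      simpa using ((hasDerivAt_id t).smul_const v).const_add x
    have h3 : HasDerivAt (fun t : ℝ => h (x + t • v)) (fderiv ℝ h (x + t • v) v) t :=
      h1.comp_hasDerivAt t h2
    rw [← inner_gradient_left] at h3
    have h4 := (hasDerivAt_id t).mul_const (inner ℝ (gradient h x) v)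
    have h5 := ((hasDerivAt_pow 2 t).const_mul (L / 2 * ‖v‖ ^ 2))
    exact ((h3.sub h4).sub h5).congr_deriv (by simp)
  have hanti : AntitoneOn (fun t : ℝ => h (x + t • v) - t * inner ℝ (gradient h x) v
      - L / 2 * ‖v‖ ^ 2 * t ^ 2) (Set.Icc 0 1) := by
    refine antitoneOn_of_deriv_nonpos (convex_Icc 0 1)
      (fun t _ => (hd t).continuousAt.continuousWithinAt)
      (fun t _ => (hd t).differentiableAt.differentiableWithinAt) fun t ht => ?_
    rw [interior_Icc] at ht
    rw [(hd t).deriv, ← inner_sub_left]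
    have h1 := real_inner_le_norm (gradient h (x + t • v) - gradient h x) v
    have h2 := hh.2 (x + t • v) x
    rw [add_sub_cancel_left, norm_smul, Real.norm_of_nonneg ht.1.le] at h2
    nlinarith [norm_nonneg v, mul_le_mul_of_nonneg_right h2 (norm_nonneg v)]
  have := hanti (Set.left_mem_Icc.2 zero_le_one) (Set.right_mem_Icc.2 zero_le_one) zero_le_one
  simp only [one_smul, zero_smul, add_zero, one_mul, zero_mul, sub_zero, hv,
    add_sub_cancel] at this
  linarith

/-- A smooth function that is bounded below by `m` satisfies the reverse of a PL inequality:
compare `h x` with the value after a gradient step of length `1 / L'`. -/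
theorem IsSmooth.norm_gradient_sq_le {L L' m : ℝ} {h : E n → ℝ} (hh : IsSmooth L h)
    (hL : L ≤ L') (hL' : 0 < L') (hm : ∀ u, m ≤ h u) (x : E n) :
    ‖gradient h x‖ ^ 2 ≤ 2 * L' * (h x - m) := by
  have h1 := (hm _).trans (hh.le_add_inner x (x - (1 / L') • gradient h x))
  rw [sub_sub_cancel_left, inner_neg_right, real_inner_smul_right, real_inner_self_eq_norm_sq,
    norm_neg, norm_smul, Real.norm_of_nonneg (by positivity)] at h1
  have h2 : L / 2 * (1 / L' * ‖gradient h x‖) ^ 2 ≤ L' / 2 * (1 / L' * ‖gradient h x‖) ^ 2 := by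
    gcongr
  have h3 : L' / 2 * (1 / L' * ‖gradient h x‖) ^ 2 = 1 / L' * ‖gradient h x‖ ^ 2 / 2 := by
    field_simp
  have h4 : 1 / L' * ‖gradient h x‖ ^ 2 ≤ 2 * (h x - m) := by linarith
  calc ‖gradient h x‖ ^ 2 = L' * (1 / L' * ‖gradient h x‖ ^ 2) := by field_simp
    _ ≤ L' * (2 * (h x - m)) := by gcongr
    _ = _ := by ring

theorem le_add_inner_of_strongConcaveOn {Y : Set (E n)} {m : ℝ} {g : E n → ℝ} {v y y' : E n}
    (hg : StrongConcaveOn Y m g) (hv : HasGradientWithinAt g v Y y) (hy : y ∈ Y) (hy' : y' ∈ Y) :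
    g y' ≤ g y + inner ℝ v (y' - y) - m / 2 * ‖y' - y‖ ^ 2 := by
  set w := y' - y with hw
  have hmem : ∀ t ∈ Set.Icc (0 : ℝ) 1, y + t • w ∈ Y := fun t ht => by
    have := hg.1 hy hy' (sub_nonneg.2 ht.2) ht.1 (by ring)
    convert this using 1
    rw [hw]; module
  have h1 : HasDerivWithinAt (fun t : ℝ => g (y + t • w)) (inner ℝ v w) (Set.Icc 0 1) 0 := by
    have h2 : HasDerivWithinAt (fun t : ℝ => y + t • w) w (Set.Icc 0 1) 0 := by
      simpa using (((hasDerivAt_id (0 : ℝ)).smul_const w).const_add y).hasDerivWithinAt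
    have h3 : HasFDerivWithinAt g (InnerProductSpace.toDual ℝ (E n) v) Y (y + (0 : ℝ) • w) := by
      simpa using hv.hasFDerivWithinAt
    have h4 : HasDerivWithinAt (fun t : ℝ => g (y + t • w))
        (InnerProductSpace.toDual ℝ (E n) v w) (Set.Icc 0 1) 0 :=
      h3.comp_hasDerivWithinAt (0 : ℝ) h2 hmem
    simpa using h4
  have h4 := hasDerivWithinAt_iff_tendsto_slope.1 h1
  have h5 : Filter.Tendsto (fun t : ℝ => g y' - g y + (1 - t) * (m / 2 * ‖w‖ ^ 2))
      (nhdsWithin 0 (Set.Icc (0 : ℝ) 1 \ {0})) (nhds (g y' - g y + (1 - 0) * (m / 2 * ‖w‖ ^ 2))) :=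
    ((continuous_const.add ((continuous_const.sub continuous_id).mul
      continuous_const)).tendsto 0).mono_left nhdsWithin_le_nhds
  have hne : (nhdsWithin (0 : ℝ) (Set.Icc (0 : ℝ) 1 \ {0})).NeBot := by
    rw [Set.Icc_sdiff_left]
    exact mem_closure_iff_nhdsWithin_neBot.1 (by rw [closure_Ioc (by norm_num)]; simp)
  have h6 := le_of_tendsto_of_tendsto h5 h4 ?_
  · linarith
  · filter_upwards [self_mem_nhdsWithin] with t ht
    have ht0 : 0 < t := lt_of_le_of_ne ht.1.1 (Ne.symm ht.2)
    have h7 := hg.2 hy hy' (sub_nonneg.2 ht.1.2) ht.1.1 (by ring)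
    have h8 : (1 - t) • y + t • y' = y + t • w := by rw [hw]; module
    rw [h8, norm_sub_rev, ← hw] at h7
    simp only [slope_def_field, sub_zero, zero_smul, add_zero]
    rw [le_div_iff₀ ht0]
    simp only [smul_eq_mul] at h7
    nlinarith

theorem add_le_of_strongConcaveOn_of_isMaxOn {Y : Set (E n)} {m : ℝ} {g : E n → ℝ} {y y' : E n}
    (hg : StrongConcaveOn Y m g) (hmax : ∀ w ∈ Y, g w ≤ g y) (hy : y ∈ Y) (hy' : y' ∈ Y) :
    g y' + m / 2 * ‖y' - y‖ ^ 2 ≤ g y := by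
  have h5 : Filter.Tendsto (fun t : ℝ => g y' + (1 - t) * (m / 2 * ‖y' - y‖ ^ 2))
      (nhdsWithin 0 (Set.Ioc (0 : ℝ) 1)) (nhds (g y' + (1 - 0) * (m / 2 * ‖y' - y‖ ^ 2))) :=
    ((continuous_const.add ((continuous_const.sub continuous_id).mul
      continuous_const)).tendsto 0).mono_left nhdsWithin_le_nhds
  have hne : (nhdsWithin (0 : ℝ) (Set.Ioc (0 : ℝ) 1)).NeBot :=
    mem_closure_iff_nhdsWithin_neBot.1 (by rw [closure_Ioc (by norm_num)]; simp)
  have h6 := le_of_tendsto h5 (b := g y) ?_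
  · linarith
  · filter_upwards [self_mem_nhdsWithin] with t ht
    have h7 := hg.2 hy hy' (sub_nonneg.2 ht.2) ht.1.le (by ring)
    have h8 := hmax _ (hg.1 hy hy' (sub_nonneg.2 ht.2) ht.1.le (by ring))
    rw [norm_sub_rev] at h7
    simp only [smul_eq_mul] at h7
    have h9 : t * (g y' + (1 - t) * (m / 2 * ‖y' - y‖ ^ 2)) ≤ t * g y := by linarith
    exact le_of_mul_le_mul_left h9 ht.1

end

/-! ### The regularized gap and best responses -/

section

variable {d d' : ℕ} {Y : Set (E d')} {f : E d → E d' → ℝ} {gy : E d → E d' → E d'}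
  {ℓ L ρ μ μx μy : ℝ}

/-- The infimum of the regularized function `f(·, y) + ρ ‖· - r‖²`; the regularization is
`(γ / 2) ‖· - r‖²` with `γ = 2 ρ`. -/
def envelope (f : E d → E d' → ℝ) (ρ : ℝ) (r : E d) (y : E d') : ℝ :=
  ⨅ u : E d, (f u y + ρ * ‖u - r‖ ^ 2)

/-- The duality gap at `(x, y)` of the regularized function `f(x, y) + ρ ‖x - r‖²`. -/
def regGap (Y : Set (E d')) (f : E d → E d' → ℝ) (ρ : ℝ) (r x : E d) (y : E d') : ℝ :=
  primal Y f x + ρ * ‖x - r‖ ^ 2 - envelope f ρ r y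

namespace IsMinMaxProblem

variable (hf : IsMinMaxProblem Y f gy ℓ L ρ μ μx μy)
include hf

theorem le_add_inner_gy (x : E d) {y y' : E d'} (hy : y ∈ Y) (hy' : y' ∈ Y) :
    f x y' ≤ f x y + inner ℝ (gy x y) (y' - y) - μy / 2 * ‖y' - y‖ ^ 2 :=
  le_add_inner_of_strongConcaveOn (hf.strongConcave x) (hf.hasGrad x y hy) hy hy'

theorem continuousOn_y (x : E d) : ContinuousOn (f x) Y := fun y hy =>
  (hf.hasGrad x y hy).differentiableWithinAt.continuousWithinAt

theorem continuous_x {y : E d'} (hy : y ∈ Y) : Continuous fun x => f x y :=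
  (hf.weaklyConvex y hy).1.continuous

theorem le_add_norm_gy_sq (hμy : 0 < μy) (x : E d) {y y' : E d'} (hy : y ∈ Y) (hy' : y' ∈ Y) :
    f x y' ≤ f x y + ‖gy x y‖ ^ 2 / (2 * μy) := by
  have h1 := hf.le_add_inner_gy x hy hy'
  have h2 := real_inner_le_norm (gy x y) (y' - y)
  have h3 : ‖gy x y‖ * ‖y' - y‖ ≤ ‖gy x y‖ ^ 2 / (2 * μy) + μy / 2 * ‖y' - y‖ ^ 2 := by
    have : 0 ≤ (‖gy x y‖ - μy * ‖y' - y‖) ^ 2 / (2 * μy) := by positivity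
    have h4 : (‖gy x y‖ - μy * ‖y' - y‖) ^ 2 / (2 * μy) =
      ‖gy x y‖ ^ 2 / (2 * μy) + μy / 2 * ‖y' - y‖ ^ 2 - ‖gy x y‖ * ‖y' - y‖ := by
      field_simp; ring
    linarith
  linarith

theorem bddAbove (hμy : 0 < μy) (x : E d) : BddAbove (Set.range fun y : Y => f x y) := by
  obtain ⟨y, hy⟩ := hf.nonempty
  refine ⟨f x y + ‖gy x y‖ ^ 2 / (2 * μy), ?_⟩
  rintro _ ⟨y', rfl⟩
  exact hf.le_add_norm_gy_sq hμy x hy y'.2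

theorem le_primal (hμy : 0 < μy) (x : E d) {y : E d'} (hy : y ∈ Y) : f x y ≤ primal Y f x :=
  le_ciSup (hf.bddAbove hμy x) (⟨y, hy⟩ : Y)

theorem primal_le (x : E d) {c : ℝ} (h : ∀ y ∈ Y, f x y ≤ c) : primal Y f x ≤ c := by
  have := hf.nonempty.to_subtype
  exact ciSup_le fun y => h y y.2

/-- The best response to `x`, with the quadratic growth given by strong concavity. -/
theorem exists_argmax (hμy : 0 < μy) (x : E d) :
    ∃ yh ∈ Y, primal Y f x = f x yh ∧ ∀ y ∈ Y, f x y + μy / 2 * ‖y - yh‖ ^ 2 ≤ f x yh := by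
  obtain ⟨y₀, hy₀⟩ := hf.nonempty
  -- outside of this ball, `f x` is below `f x y₀`
  set R := 2 * ‖gy x y₀‖ / μy
  have hR : 0 ≤ R := by positivity
  have hc : IsCompact (Y ∩ Metric.closedBall y₀ R) :=
    (isCompact_closedBall y₀ R).inter_left hf.closed
  obtain ⟨yh, hyh, hmax⟩ := hc.exists_isMaxOn ⟨y₀, hy₀, Metric.mem_closedBall_self hR⟩
    ((hf.continuousOn_y x).mono Set.inter_subset_left)
  have hmax' : ∀ y ∈ Y, f x y ≤ f x yh := fun y hy => by
    by_cases hyR : y ∈ Metric.closedBall y₀ R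
    · exact hmax ⟨hy, hyR⟩
    · refine le_trans ?_ (hmax ⟨hy₀, Metric.mem_closedBall_self hR⟩)
      have h1 := hf.le_add_inner_gy x hy₀ hy
      have h2 := real_inner_le_norm (gy x y₀) (y - y₀)
      rw [Metric.mem_closedBall, not_le, dist_eq_norm, div_lt_iff₀ hμy] at hyR
      nlinarith [norm_nonneg (y - y₀)]
  exact ⟨yh, hyh.1, le_antisymm (hf.primal_le x hmax') (hf.le_primal hμy x hyh.1), fun y hy =>
    add_le_of_strongConcaveOn_of_isMaxOn (hf.strongConcave x) hmax' hyh.1 hy⟩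

theorem bddBelow_reg (hρ : 0 < ρ) (r : E d) {y : E d'} (hy : y ∈ Y) :
    BddBelow (Set.range fun u : E d => f u y + ρ * ‖u - r‖ ^ 2) := by
  obtain ⟨xs, hxs, -⟩ := hf.xPL y hy
  refine ⟨f xs y, ?_⟩
  rintro _ ⟨u, rfl⟩
  exact (hxs u).trans (le_add_of_nonneg_right (by positivity))

theorem envelope_le (hρ : 0 < ρ) (r u : E d) {y : E d'} (hy : y ∈ Y) :
    envelope f ρ r y ≤ f u y + ρ * ‖u - r‖ ^ 2 :=
  ciInf_le (hf.bddBelow_reg hρ r hy) u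

/-- The proximal point `u` of `f(·, y)` at `r`; the regularized function is `ρ`-strongly convex. -/
theorem exists_argmin (hρ : 0 < ρ) (r : E d) {y : E d'} (hy : y ∈ Y) :
    ∃ u : E d, envelope f ρ r y = f u y + ρ * ‖u - r‖ ^ 2 ∧ gradX f u y = -((2 * ρ) • (u - r)) ∧
      ∀ x, f u y + ρ * ‖u - r‖ ^ 2 + ρ / 2 * ‖x - u‖ ^ 2 ≤ f x y + ρ * ‖x - r‖ ^ 2 := by
  obtain ⟨xs, hxs, -⟩ := hf.xPL y hy
  have hcont : Continuous fun u : E d => f u y + ρ * ‖u - r‖ ^ 2 := by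
    have := hf.continuous_x hy
    fun_prop
  obtain ⟨u, -, hu⟩ := hcont.continuousOn.exists_isMinOn' (s := Set.univ) isClosed_univ
    (x₀ := r) (Set.mem_univ _) (by
      have h1 : Filter.Tendsto (fun u : E d => f xs y + ρ * ‖u - r‖ ^ 2)
          (Filter.cocompact (E d)) Filter.atTop := by
        refine Filter.tendsto_atTop_add_const_left _ _ (Filter.Tendsto.const_mul_atTop hρ ?_)
        refine (Filter.tendsto_pow_atTop two_ne_zero).comp ?_
        simpa only [dist_eq_norm] using tendsto_dist_right_cocompact_atTop r
      filter_upwards [Filter.mem_inf_of_left (h1.eventually_ge_atTop (f r y + ρ * ‖r - r‖ ^ 2))]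
        with u hu
      exact hu.trans (by linarith [hxs u]))
  have hmin : ∀ x, f u y + ρ * ‖u - r‖ ^ 2 ≤ f x y + ρ * ‖x - r‖ ^ 2 := fun x => hu (Set.mem_univ x)
  have hgrad : gradX f u y = -((2 * ρ) • (u - r)) := by
    have h1 : HasGradientAt (fun u => f u y) (gradX f u y) u :=
      ((hf.weaklyConvex y hy).1 u).hasGradientAt
    have h2 : HasFDerivAt (fun u : E d => f u y + ρ * ‖u - r‖ ^ 2)
        (InnerProductSpace.toDual ℝ (E d) (gradX f u y)
          + ρ • (2 • (innerSL ℝ (u - r)).comp (ContinuousLinearMap.id ℝ (E d)))) u := by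
      refine h1.hasFDerivAt.add (HasFDerivAt.const_mul ?_ ρ)
      exact ((hasFDerivAt_id u).sub_const r).norm_sq
    have h3 : IsLocalMin (fun u : E d => f u y + ρ * ‖u - r‖ ^ 2) u :=
      Filter.Eventually.of_forall hmin
    have h4 := h3.hasFDerivAt_eq_zero h2
    refine ext_inner_right ℝ fun w => ?_
    have h5 := DFunLike.congr_fun h4 w
    simp at h5
    simp only [inner_neg_left, real_inner_smul_left, inner_sub_left]
    linarith
  refine ⟨u, le_antisymm (hf.envelope_le hρ r u hy) (le_ciInf hmin), hgrad, fun x => ?_⟩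
  have h1 := (hf.weaklyConvex y hy).2 x u
  change inner ℝ (gradX f u y) (x - u) - _ ≤ _ at h1
  have h2 : ‖x - r‖ ^ 2 = ‖x - u‖ ^ 2 + 2 * inner ℝ (x - u) (u - r) + ‖u - r‖ ^ 2 := by
    rw [← norm_add_sq_real, sub_add_sub_cancel]
  rw [hgrad, inner_neg_left, real_inner_smul_left, real_inner_comm] at h1
  rw [h2]
  linarith

end IsMinMaxProblem

end

/-! ### Inequalities for one proximal stage -/

section

variable {d d' : ℕ} {Y : Set (E d')} {f : E d → E d' → ℝ} {gy : E d → E d' → E d'}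
  {ℓ L ρ μ μx μy : ℝ}

/-- The proximal regularization `ρ ‖· - r‖²` of an `L`-smooth function is `(L + 2 ρ)`-smooth. -/
theorem IsSmooth.add_mul_norm_sub_sq {h : E d → ℝ} (hh : IsSmooth L h) (hρ : 0 < ρ) (r : E d) :
    IsSmooth (L + 2 * ρ) (fun u => h u + ρ * ‖u - r‖ ^ 2) ∧
      ∀ u, gradient (fun u => h u + ρ * ‖u - r‖ ^ 2) u = gradient h u + (2 * ρ) • (u - r) := by
  have hgrad : ∀ u, HasGradientAt (fun u => h u + ρ * ‖u - r‖ ^ 2)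
      (gradient h u + (2 * ρ) • (u - r)) u := fun u => by
    have h2 : HasFDerivAt (fun u : E d => h u + ρ * ‖u - r‖ ^ 2)
        (InnerProductSpace.toDual ℝ (E d) (gradient h u)
          + ρ • (2 • (innerSL ℝ (u - r)).comp (ContinuousLinearMap.id ℝ (E d)))) u := by
      refine (hh.1 u).hasGradientAt.hasFDerivAt.add (HasFDerivAt.const_mul ?_ ρ)
      exact ((hasFDerivAt_id u).sub_const r).norm_sq
    have h3 : InnerProductSpace.toDual ℝ (E d) (gradient h u + (2 * ρ) • (u - r))
        = InnerProductSpace.toDual ℝ (E d) (gradient h u)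
          + ρ • (2 • (innerSL ℝ (u - r)).comp (ContinuousLinearMap.id ℝ (E d))) := by
      refine ContinuousLinearMap.ext fun w => ?_
      simp
      ring
    rw [hasGradientAt_iff_hasFDerivAt, h3]
    exact h2
  refine ⟨⟨fun u => (hgrad u).differentiableAt, fun u v => ?_⟩, fun u => (hgrad u).gradient⟩
  rw [(hgrad u).gradient, (hgrad v).gradient]
  have h1 : gradient h u + (2 * ρ) • (u - r) - (gradient h v + (2 * ρ) • (v - r))
      = (gradient h u - gradient h v) + (2 * ρ) • (u - v) := by module
  rw [h1]
  refine (norm_add_le _ _).trans ?_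
  rw [norm_smul, Real.norm_of_nonneg (by positivity), add_mul]
  gcongr
  exact hh.2 u v

namespace IsMinMaxProblem

theorem iInf_le_x (hf : IsMinMaxProblem Y f gy ℓ L ρ μ μx μy) {x : E d} {y : E d'} (hy : y ∈ Y) : ⨅ x', f x' y ≤ f x y := by
  obtain ⟨xs, hxs, -⟩ := hf.xPL y hy
  refine ciInf_le ⟨f xs y, ?_⟩ x
  rintro _ ⟨u, rfl⟩
  exact hxs u

section
variable (hf : IsMinMaxProblem Y f gy ℓ L ρ μ μx μy) (hρ : 0 < ρ) (hμy : 0 < μy)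
include hf hρ hμy

theorem envelope_le_primal (r u : E d) {y : E d'} (hy : y ∈ Y) :
    envelope f ρ r y ≤ primal Y f u + ρ * ‖u - r‖ ^ 2 :=
  (hf.envelope_le hρ r u hy).trans (by gcongr; exact hf.le_primal hμy u hy)

theorem regGap_nonneg (r x : E d) {y : E d'} (hy : y ∈ Y) : 0 ≤ regGap Y f ρ r x y :=
  sub_nonneg.2 (hf.envelope_le_primal hρ hμy r x hy)

/-- The distance moved in a stage is controlled by the regularized gap and the decrease of the
primal function. -/
theorem mul_norm_sub_sq_le (r x : E d) {y : E d'} (hy : y ∈ Y) :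
    ρ * ‖x - r‖ ^ 2 ≤ regGap Y f ρ r x y + primal Y f r - primal Y f x := by
  have := hf.envelope_le_primal hρ hμy r r hy
  simp only [sub_self, norm_zero] at this
  unfold regGap
  linarith

/-- One inexact proximal point step decreases the primal suboptimality, by the PL condition. -/
theorem primal_decrease (hL : 0 ≤ L) {xs : E d}
    (hPL : ∀ x, 2 * μ * (primal Y f x - primal Y f xs) ≤ ‖gradient (primal Y f) x‖ ^ 2)
    (r x : E d) {y : E d'} (hy : y ∈ Y) :
    (8 * ρ + 2 * μ) * (primal Y f x - primal Y f xs) ≤ 8 * ρ * (primal Y f r - primal Y f xs)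
      + (4 * (L + 2 * ρ) + 8 * ρ) * regGap Y f ρ r x y := by
  obtain ⟨hs, hg⟩ := hf.smooth.add_mul_norm_sub_sq hρ r
  have h1 := hs.norm_gradient_sq_le le_rfl (by positivity)
    (fun u => hf.envelope_le_primal hρ hμy r u hy) x
  rw [hg] at h1
  have h2 := hPL x
  have h3 : gradient (primal Y f) x
      = (gradient (primal Y f) x + (2 * ρ) • (x - r)) - (2 * ρ) • (x - r) := by module
  have h4 : ‖gradient (primal Y f) x‖ ^ 2
      ≤ 2 * ‖gradient (primal Y f) x + (2 * ρ) • (x - r)‖ ^ 2 + 8 * ρ * (ρ * ‖x - r‖ ^ 2) := by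
    have h5 := norm_sub_le (gradient (primal Y f) x + (2 * ρ) • (x - r)) ((2 * ρ) • (x - r))
    rw [← h3, norm_smul, Real.norm_of_nonneg (by positivity : (0 : ℝ) ≤ 2 * ρ)] at h5
    have h6 := pow_le_pow_left₀ (norm_nonneg _) h5 2
    nlinarith [sq_nonneg (‖gradient (primal Y f) x + (2 * ρ) • (x - r)‖ - 2 * ρ * ‖x - r‖)]
  have h5 := hf.mul_norm_sub_sq_le hρ hμy r x hy
  have h6 := mul_le_mul_of_nonneg_left h5 (by positivity : 0 ≤ 8 * ρ)
  have h7 : primal Y f x + ρ * ‖x - r‖ ^ 2 - envelope f ρ r y = regGap Y f ρ r x y := rfl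
  rw [h7] at h1
  linarith

/-- The gap of the next stage at its starting point, in terms of the gap reached in this stage. -/
theorem regGap_self_le (r x : E d) {y : E d'} (hy : y ∈ Y) :
    regGap Y f ρ x x y
      ≤ 10 * regGap Y f ρ r x y + 8 * (primal Y f r - primal Y f x) := by
  obtain ⟨u, hu, -, hmin⟩ := hf.exists_argmin hρ x hy
  have h1 := hmin x
  have h2 := hf.envelope_le hρ r u hy
  have h3 := hf.le_primal hμy x hy
  have h4 := hf.mul_norm_sub_sq_le hρ hμy r x hy
  have h5 : ‖u - r‖ ^ 2 = ‖u - x‖ ^ 2 + 2 * inner ℝ (u - x) (x - r) + ‖x - r‖ ^ 2 := by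
    rw [← norm_add_sq_real, sub_add_sub_cancel]
  have h6 := real_inner_le_norm (u - x) (x - r)
  rw [norm_sub_rev x u] at h1
  simp only [sub_self, norm_zero] at h1
  have h7 : 2 * (ρ * (‖u - x‖ * ‖x - r‖)) ≤ ρ * ‖u - x‖ ^ 2 / 4 + 4 * (ρ * ‖x - r‖ ^ 2) := by
    nlinarith [mul_nonneg hρ.le (sq_nonneg (‖u - x‖ / 2 - 2 * ‖x - r‖))]
  have h8 := mul_le_mul_of_nonneg_left h6 hρ.le
  rw [h5] at h2
  unfold regGap at *
  rw [hu]
  simp only [sub_self, norm_zero]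
  linarith

/-- The distances from the starting point to the best responses to the output of a stage are
controlled by the gaps at the two ends of the stage. -/
theorem exists_best_responses (r x : E d) {y y₀ : E d'} (hy : y ∈ Y) (hy₀ : y₀ ∈ Y) :
    ∃ u : E d, ∃ v ∈ Y,
      regGap Y f ρ r x y = f x v + ρ * ‖x - r‖ ^ 2 - (f u y + ρ * ‖u - r‖ ^ 2) ∧
      gradX f u y = -((2 * ρ) • (u - r)) ∧
      ρ / 2 * ‖u - r‖ ^ 2 + μy / 2 * ‖v - y₀‖ ^ 2
        ≤ regGap Y f ρ r r y₀ + regGap Y f ρ r x y := by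
  obtain ⟨u, hu, hgrad, hmin⟩ := hf.exists_argmin hρ r hy
  obtain ⟨v, hv, hPv, hmax⟩ := hf.exists_argmax hμy x
  refine ⟨u, v, hv, by rw [regGap, hu, hPv], hgrad, ?_⟩
  have h1 := hmin r
  have h2 := hmax y₀ hy₀
  have h3 := hf.le_primal hμy r hy
  have h4 := hf.envelope_le hρ r x hy₀
  rw [norm_sub_rev r u] at h1
  rw [norm_sub_rev y₀ v] at h2
  simp only [regGap, sub_self, norm_zero] at *
  linarith

/-- A regret bound against all comparison points bounds the gap at the output `(x, y)` of a stage
that starts at `(r, y₀)`. -/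
theorem regGap_le_of_forall {r x : E d} {y y₀ : E d'} (hy : y ∈ Y) (hy₀ : y₀ ∈ Y) {κ W : ℝ}
    (hκ : 0 ≤ κ)
    (h : ∀ u : E d, ∀ v ∈ Y, f x v + ρ * ‖x - r‖ ^ 2 - (f u y + ρ * ‖u - r‖ ^ 2)
      ≤ κ * (‖u - r‖ ^ 2 + ‖v - y₀‖ ^ 2) + W) :
    regGap Y f ρ r x y
      ≤ 2 * κ / min ρ μy * (regGap Y f ρ r r y₀ + regGap Y f ρ r x y) + W := by
  obtain ⟨u, v, hv, hG, -, huv⟩ := hf.exists_best_responses hρ hμy r x hy hy₀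
  have h1 := h u v hv
  rw [← hG] at h1
  have hm : 0 < min ρ μy := lt_min hρ hμy
  have h2 : min ρ μy / 2 * (‖u - r‖ ^ 2 + ‖v - y₀‖ ^ 2)
      ≤ regGap Y f ρ r r y₀ + regGap Y f ρ r x y := by
    refine le_trans ?_ huv
    rw [mul_add]
    gcongr
    · exact min_le_left _ _
    · exact min_le_right _ _
  have h3 : κ * (‖u - r‖ ^ 2 + ‖v - y₀‖ ^ 2)
      = 2 * κ / min ρ μy * (min ρ μy / 2 * (‖u - r‖ ^ 2 + ‖v - y₀‖ ^ 2)) := by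
    field_simp
  have h4 := mul_le_mul_of_nonneg_left h2 (by positivity : 0 ≤ 2 * κ / min ρ μy)
  linarith

/-- A bound by quadratic quantities, which makes the gap integrable at square integrable
points. -/
theorem regGap_le_norm_sq (r x : E d) {y : E d'} (hy : y ∈ Y) :
    regGap Y f ρ r x y ≤ primal Y f x - primal Y f r + ‖gy r y‖ ^ 2 / (2 * μy)
      + ‖gradX f r y‖ ^ 2 / (2 * ρ) + ρ * ‖x - r‖ ^ 2 := by
  have h1 : primal Y f r ≤ f r y + ‖gy r y‖ ^ 2 / (2 * μy) :=
    hf.primal_le r fun y' hy' => hf.le_add_norm_gy_sq hμy r hy hy'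
  have h2 : f r y - ‖gradX f r y‖ ^ 2 / (2 * ρ) ≤ envelope f ρ r y := by
    refine le_ciInf fun u => ?_
    have h3 := (hf.weaklyConvex y hy).2 u r
    change inner ℝ (gradX f r y) (u - r) - _ ≤ _ at h3
    have h4 := neg_le_of_abs_le (abs_real_inner_le_norm (gradX f r y) (u - r))
    have h5 : 0 ≤ (‖gradX f r y‖ - ρ * ‖u - r‖) ^ 2 / (2 * ρ) := by positivity
    have h6 : (‖gradX f r y‖ - ρ * ‖u - r‖) ^ 2 / (2 * ρ) =
        ‖gradX f r y‖ ^ 2 / (2 * ρ) + ρ / 2 * ‖u - r‖ ^ 2 - ‖gradX f r y‖ * ‖u - r‖ := by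
      field_simp; ring
    linarith
  unfold regGap
  linarith

/-- The `x`-side PL condition bounds the duality gap by the regularized gaps of a stage. -/
theorem gap_le (hμx : 0 < μx) (r x : E d) {y y₀ : E d'} (hy : y ∈ Y) (hy₀ : y₀ ∈ Y) :
    gap Y f x y ≤ regGap Y f ρ r x y
      + (2 + 4 * (ρ / μx)) * (regGap Y f ρ r r y₀ + regGap Y f ρ r x y) := by
  obtain ⟨u, v, hv, hG, hgrad, huv⟩ := hf.exists_best_responses hρ hμy r x hy hy₀
  obtain ⟨u', hu', hgrad', hmin⟩ := hf.exists_argmin hρ r hy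
  obtain ⟨xs, hxs, hPL⟩ := hf.xPL y hy
  have h1 : f xs y ≤ ⨅ x', f x' y := le_ciInf hxs
  have h2 := hPL u
  change _ ≤ ‖gradX f u y‖ ^ 2 at h2
  rw [hgrad, norm_neg, norm_smul, Real.norm_of_nonneg (by positivity)] at h2
  have h3 : f u y - f xs y ≤ (ρ / 2 * ‖u - r‖ ^ 2) * (4 * (ρ / μx)) := by
    rw [← mul_le_mul_iff_right₀ (by positivity : 0 < 2 * μx)]
    refine h2.trans (le_of_eq ?_)
    field_simp
    ring
  have h4 : ρ / 2 * ‖u - r‖ ^ 2 ≤ regGap Y f ρ r r y₀ + regGap Y f ρ r x y :=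
    le_trans (le_add_of_nonneg_right (by positivity)) huv
  have h5 := mul_le_mul_of_nonneg_right h4 (by positivity : 0 ≤ 4 * (ρ / μx))
  have h6 : primal Y f x ≤ regGap Y f ρ r x y + f u y + ρ * ‖u - r‖ ^ 2 := by
    have h7 := hf.envelope_le hρ r u hy
    have h8 : 0 ≤ ρ * ‖x - r‖ ^ 2 := by positivity
    unfold regGap
    linarith
  have h7 : gap Y f x y = primal Y f x - ⨅ x', f x' y := rfl
  rw [h7]
  linarith

end

theorem regGap_self_le_gap (hf : IsMinMaxProblem Y f gy ℓ L ρ μ μx μy) (hρ : 0 < ρ) (x : E d)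
    {y : E d'} (hy : y ∈ Y) : regGap Y f ρ x x y ≤ gap Y f x y := by
  have h1 : ⨅ x', f x' y ≤ envelope f ρ x y := le_ciInf fun u =>
    (hf.iInf_le_x hy).trans (le_add_of_nonneg_right (by positivity))
  have h7 : gap Y f x y = primal Y f x - ⨅ x', f x' y := rfl
  rw [h7]
  simp only [regGap, sub_self, norm_zero]
  linarith

theorem primal_sub_le_gap (hf : IsMinMaxProblem Y f gy ℓ L ρ μ μx μy) (hμy : 0 < μy) (x u : E d)
    {y : E d'} (hy : y ∈ Y) : primal Y f x - primal Y f u ≤ gap Y f x y := by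
  have h1 := (hf.iInf_le_x hy (x := u)).trans (hf.le_primal hμy u hy)
  have h7 : gap Y f x y = primal Y f x - ⨅ x', f x' y := rfl
  rw [h7]
  linarith

theorem gap_nonneg (hf : IsMinMaxProblem Y f gy ℓ L ρ μ μx μy) (hμy : 0 < μy) (x : E d)
    {y : E d'} (hy : y ∈ Y) : 0 ≤ gap Y f x y := by
  simpa using hf.primal_sub_le_gap hμy x x hy


/-- Smoothness and the PL condition limit `μ`, unless the primal function is constant. -/
theorem mu_le (hf : IsMinMaxProblem Y f gy ℓ L ρ μ μx μy) (hρ : 0 < ρ) (hL : 0 ≤ L) :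
    μ ≤ L + 2 * ρ := by
  obtain ⟨xs, hxs, hPL⟩ := hf.primalPL
  by_cases hc : ∀ x, primal Y f x ≤ primal Y f xs
  · exact hf.const fun x x' => ((hc x).trans (hxs x')).antisymm ((hc x').trans (hxs x))
  · push Not at hc
    obtain ⟨x, hx⟩ := hc
    have h1 := hf.smooth.norm_gradient_sq_le (L' := L + 2 * ρ) (by linarith) (by positivity) hxs x
    have h2 := (hPL x).trans h1
    have h3 := le_of_mul_le_mul_right h2 (sub_pos.2 hx)
    linarith

end IsMinMaxProblem

end

/-! ### Projections and the regret of optimistic gradient descent ascent -/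

section

section Projection

variable {H : Type*} [NormedAddCommGroup H] [InnerProductSpace ℝ H]

/-- The metric projection of `v` onto the closed convex set `K`, described by its variational
inequality. -/
def proj (K : Set H) (v : H) : H :=
  Classical.epsilon fun z => z ∈ K ∧ ∀ w ∈ K, inner ℝ (v - z) (w - z) ≤ 0

theorem proj_eq {K : Set H} {v z : H} (hz : z ∈ K) (h : ∀ w ∈ K, inner ℝ (v - z) (w - z) ≤ 0) :
    proj K v = z := by
  obtain ⟨h1, h2⟩ := Classical.epsilon_spec
    (p := fun z => z ∈ K ∧ ∀ w ∈ K, inner ℝ (v - z) (w - z) ≤ 0) ⟨z, hz, h⟩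
  change proj K v ∈ K at h1
  change ∀ w ∈ K, inner ℝ (v - proj K v) (w - proj K v) ≤ 0 at h2
  have h3 := h _ h1
  have h4 := h2 _ hz
  have h5 : inner ℝ (proj K v - z) (proj K v - z) ≤ 0 := by
    have h6 : proj K v - z = (v - z) - (v - proj K v) := by abel
    have h7 : z - proj K v = -(proj K v - z) := by abel
    rw [h7, inner_neg_right] at h4
    nth_rewrite 1 [h6]
    rw [inner_sub_left]
    linarith
  exact sub_eq_zero.1 (real_inner_self_nonpos.1 h5)

variable [CompleteSpace H] {K : Set H} (hK : K.Nonempty) (hc : IsClosed K) (hconv : Convex ℝ K)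
include hK hc hconv

theorem proj_spec (v : H) : proj K v ∈ K ∧ ∀ w ∈ K, inner ℝ (v - proj K v) (w - proj K v) ≤ 0 := by
  refine Classical.epsilon_spec
    (p := fun z => z ∈ K ∧ ∀ w ∈ K, inner ℝ (v - z) (w - z) ≤ 0) ?_
  obtain ⟨z, hz, h⟩ := exists_norm_eq_iInf_of_complete_convex hK hc.isComplete hconv v
  exact ⟨z, hz, (norm_eq_iInf_iff_real_inner_le_zero hconv hz).1 h⟩

theorem norm_proj_sub_proj_le (v w : H) : ‖proj K v - proj K w‖ ≤ ‖v - w‖ := by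
  obtain ⟨hv, hv'⟩ := proj_spec hK hc hconv v
  obtain ⟨hw, hw'⟩ := proj_spec hK hc hconv w
  have h1 := hv' _ hw
  have h2 := hw' _ hv
  set p := proj K v
  set q := proj K w
  have h3 : ‖p - q‖ ^ 2 ≤ inner ℝ (v - w) (p - q) := by
    have h4 : q - p = -(p - q) := by abel
    rw [h4, inner_neg_right] at h1
    have h5 : v - w = (v - p) - (w - q) + (p - q) := by abel
    rw [h5, inner_add_left, inner_sub_left, real_inner_self_eq_norm_sq]
    linarith
  have h4 := h3.trans (real_inner_le_norm _ _)
  by_contra! h5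
  nlinarith [norm_nonneg (p - q), norm_nonneg (v - w)]

theorem continuous_proj : Continuous (proj K) :=
  (LipschitzWith.of_dist_le_mul (K := 1) fun v w => by
    simpa [dist_eq_norm] using norm_proj_sub_proj_le hK hc hconv v w).continuous

/-- The three-point inequality of a proximal step from `a` along `g`. -/
theorem inner_proj_sub_le (a g : H) {w : H} (hw : w ∈ K) :
    inner ℝ g (proj K (a - g) - w) ≤ ‖w - a‖ ^ 2 / 2 - ‖w - proj K (a - g)‖ ^ 2 / 2
      - ‖proj K (a - g) - a‖ ^ 2 / 2 := by
  have h1 := (proj_spec hK hc hconv (a - g)).2 w hw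
  set p := proj K (a - g)
  have h2 : ‖w - a‖ ^ 2 = ‖w - p‖ ^ 2 + 2 * inner ℝ (w - p) (p - a) + ‖p - a‖ ^ 2 := by
    rw [← norm_add_sq_real, sub_add_sub_cancel]
  have h3 : a - g - p = -(p - a) - g := by abel
  have h4 : p - w = -(w - p) := by abel
  rw [h3, inner_sub_left, inner_neg_left, real_inner_comm] at h1
  rw [h4, inner_neg_right]
  linarith

/-- One step of optimistic gradient descent ascent: `z' = Π(a - g)` and `a' = Π(a - g')`. The
terms `‖z - a‖²` telescope and absorb the change `‖z' - z‖²` of the operator. -/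
theorem optimistic_step {a z z' a' g g' n n' w : H} {Λ : ℝ} (hw : w ∈ K)
    (hz' : z' = proj K (a - g)) (ha' : a' = proj K (a - g'))
    (hlip : ‖(g' - n') - (g - n)‖ ≤ Λ * ‖z' - z‖) (hΛ : 6 * Λ ^ 2 ≤ 1 / 4) :
    inner ℝ g' (z' - w) + ‖w - a'‖ ^ 2 / 2 + ‖z' - a'‖ ^ 2 / 4
      ≤ ‖w - a‖ ^ 2 / 2 + ‖z - a‖ ^ 2 / 4 + 3 * (‖n'‖ ^ 2 + ‖n‖ ^ 2) := by
  have ha'K : a' ∈ K := ha' ▸ (proj_spec hK hc hconv _).1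
  have h1 := inner_proj_sub_le hK hc hconv a g' hw
  have h2 := inner_proj_sub_le hK hc hconv a g ha'K
  rw [← ha'] at h1
  rw [← hz', norm_sub_rev a' z'] at h2
  have h3 : inner ℝ g' (z' - w) = inner ℝ g' (a' - w) + inner ℝ g (z' - a')
      + inner ℝ (g' - g) (z' - a') := by
    simp only [inner_sub_left, inner_sub_right]; ring
  have h4 : inner ℝ (g' - g) (z' - a') ≤ ‖g' - g‖ ^ 2 + ‖z' - a'‖ ^ 2 / 4 := by
    have := real_inner_le_norm (g' - g) (z' - a')
    nlinarith [sq_nonneg (‖g' - g‖ - ‖z' - a'‖ / 2)]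
  have h5 : ‖g' - g‖ ≤ Λ * ‖z' - z‖ + ‖n'‖ + ‖n‖ := by
    have h6 : g' - g = ((g' - n') - (g - n)) + n' - n := by abel
    rw [h6]
    refine (norm_sub_le _ _).trans ?_
    gcongr
    refine (norm_add_le _ _).trans ?_
    gcongr
  have h6 : ‖g' - g‖ ^ 2 ≤ 3 * (Λ ^ 2 * ‖z' - z‖ ^ 2 + ‖n'‖ ^ 2 + ‖n‖ ^ 2) := by
    have h7 := pow_le_pow_left₀ (norm_nonneg _) h5 2
    nlinarith [sq_nonneg (Λ * ‖z' - z‖ - ‖n'‖), sq_nonneg (Λ * ‖z' - z‖ - ‖n‖),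
      sq_nonneg (‖n'‖ - ‖n‖)]
  have h7 : ‖z' - z‖ ^ 2 ≤ 2 * (‖z' - a‖ ^ 2 + ‖z - a‖ ^ 2) := by
    have h8 : ‖z' - z‖ ≤ ‖z' - a‖ + ‖z - a‖ := by
      rw [← sub_sub_sub_cancel_right z' z a]; exact norm_sub_le _ _
    have h9 := pow_le_pow_left₀ (norm_nonneg _) h8 2
    nlinarith [sq_nonneg (‖z' - a‖ - ‖z - a‖)]
  have h8 : 3 * (Λ ^ 2 * ‖z' - z‖ ^ 2) ≤ (‖z' - a‖ ^ 2 + ‖z - a‖ ^ 2) / 4 := by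
    have h9 := mul_le_mul_of_nonneg_left h7 (by positivity : 0 ≤ 3 * Λ ^ 2)
    have h10 := mul_le_mul_of_nonneg_right hΛ (by positivity : 0 ≤ ‖z' - a‖ ^ 2 + ‖z - a‖ ^ 2)
    linarith
  rw [norm_sub_rev a' a] at h1
  rw [norm_sub_rev a' a] at h2
  linarith [sq_nonneg ‖z' - a‖]

/-- The regret of optimistic gradient descent ascent with stochastic gradients `g t`, where
`g t - n t` is a Lipschitz function of `z t`. -/
theorem optimistic_regret {z a g n : ℕ → H} {η Λ : ℝ} (hη : 0 ≤ η) (h0 : a 0 = z 0)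
    (hz : ∀ t, z (t + 1) = proj K (a t - η • g t))
    (ha : ∀ t, a (t + 1) = proj K (a t - η • g (t + 1)))
    (hlip : ∀ t, ‖(g (t + 1) - n (t + 1)) - (g t - n t)‖ ≤ Λ * ‖z (t + 1) - z t‖)
    (hΛ : 6 * (η * Λ) ^ 2 ≤ 1 / 4) {w : H} (hw : w ∈ K) (T : ℕ) :
    ∑ t ∈ Finset.range T, η * inner ℝ (g (t + 1)) (z (t + 1) - w) + ‖w - a T‖ ^ 2 / 2
        + ‖z T - a T‖ ^ 2 / 4
      ≤ ‖w - z 0‖ ^ 2 / 2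
        + ∑ t ∈ Finset.range T, 3 * η ^ 2 * (‖n (t + 1)‖ ^ 2 + ‖n t‖ ^ 2) := by
  induction T with
  | zero => simp [h0]
  | succ T ih =>
    rw [Finset.sum_range_succ, Finset.sum_range_succ]
    have h1 := optimistic_step hK hc hconv (n := η • n T) (n' := η • n (T + 1)) (z := z T)
      (Λ := η * Λ) hw (hz T) (ha T) (by
        have h2 := mul_le_mul_of_nonneg_left (hlip T) hη
        rw [← smul_sub, ← smul_sub, ← smul_sub, norm_smul, Real.norm_of_nonneg hη]
        linarith) hΛ
    rw [real_inner_smul_left, norm_smul, norm_smul, Real.norm_of_nonneg hη] at h1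
    linarith

omit [CompleteSpace H] hK hc hconv in
/-- The sequence `z₀ + η ∑ nₛ` decouples the comparison point `w` from the noise. -/
theorem sum_inner_ghost_eq (z₀ w : H) (n : ℕ → H) (η : ℝ) (T : ℕ) :
    - (‖w - z₀‖ ^ 2 / 2) - ∑ t ∈ Finset.range T, η ^ 2 / 2 * ‖n (t + 1)‖ ^ 2
        + ‖w - (z₀ + η • ∑ s ∈ Finset.range T, n (s + 1))‖ ^ 2 / 2
      = ∑ t ∈ Finset.range T,
        η * inner ℝ (n (t + 1)) (z₀ + η • ∑ s ∈ Finset.range t, n (s + 1) - w) := by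
  induction T with
  | zero => simp
  | succ T ih =>
    rw [Finset.sum_range_succ, Finset.sum_range_succ, Finset.sum_range_succ, ← ih]
    set v := z₀ + η • ∑ s ∈ Finset.range T, n (s + 1)
    have h1 : w - (z₀ + η • (∑ s ∈ Finset.range T, n (s + 1) + n (T + 1)))
        = (w - v) - η • n (T + 1) := by
      simp only [v]; module
    have h2 : v - w = -(w - v) := by abel
    rw [h1, norm_sub_sq_real (w - v), norm_smul, real_inner_smul_right, h2, inner_neg_right,
      real_inner_comm, mul_pow, Real.norm_eq_abs, sq_abs]
    ring

/-- The regret bound, with the noise `n t` taken out of the stochastic gradients `g t`. -/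
theorem optimistic_regret_mean {z a g n : ℕ → H} {η Λ : ℝ} (hη : 0 ≤ η) (h0 : a 0 = z 0)
    (hz : ∀ t, z (t + 1) = proj K (a t - η • g t))
    (ha : ∀ t, a (t + 1) = proj K (a t - η • g (t + 1)))
    (hlip : ∀ t, ‖(g (t + 1) - n (t + 1)) - (g t - n t)‖ ≤ Λ * ‖z (t + 1) - z t‖)
    (hΛ : 6 * (η * Λ) ^ 2 ≤ 1 / 4) {w : H} (hw : w ∈ K) (T : ℕ) :
    ∑ t ∈ Finset.range T, η * inner ℝ (g (t + 1) - n (t + 1)) (z (t + 1) - w)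
      ≤ ‖w - z 0‖ ^ 2
        + ∑ t ∈ Finset.range T, (3 * η ^ 2 * (‖n (t + 1)‖ ^ 2 + ‖n t‖ ^ 2)
          + η ^ 2 / 2 * ‖n (t + 1)‖ ^ 2
          - η * inner ℝ (n (t + 1))
            (z (t + 1) - (z 0 + η • ∑ s ∈ Finset.range t, n (s + 1)))) := by
  have h1 := optimistic_regret hK hc hconv hη h0 hz ha hlip hΛ hw T
  have h2 := sum_inner_ghost_eq (z 0) w n η T
  have h3 : ∀ t, η * inner ℝ (g (t + 1) - n (t + 1)) (z (t + 1) - w)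
      = η * inner ℝ (g (t + 1)) (z (t + 1) - w)
        - η * inner ℝ (n (t + 1)) (z (t + 1) - (z 0 + η • ∑ s ∈ Finset.range t, n (s + 1)))
        - η * inner ℝ (n (t + 1)) (z 0 + η • ∑ s ∈ Finset.range t, n (s + 1) - w) := fun t => by
    simp only [inner_sub_left, inner_sub_right]; ring
  simp only [h3, Finset.sum_sub_distrib, Finset.sum_add_distrib] at *
  nlinarith [sq_nonneg ‖w - a T‖, sq_nonneg ‖z T - a T‖,
    sq_nonneg ‖w - (z 0 + η • ∑ s ∈ Finset.range T, n (s + 1))‖]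

end Projection

section Product

variable {d d' : ℕ} {Y : Set (E d')}

/-- The Euclidean space `ℝ^(d+d')`. -/
abbrev H (d d' : ℕ) : Type := WithLp 2 (E d × E d')

/-- The feasible set `ℝ^d × Y` as a subset of `ℝ^(d+d')`. -/
def feasible (d : ℕ) {d' : ℕ} (Y : Set (E d')) : Set (H d d') := {z | z.snd ∈ Y}

theorem feasible_nonempty (h : Y.Nonempty) : (feasible d Y).Nonempty := by
  obtain ⟨y, hy⟩ := h
  exact ⟨WithLp.toLp 2 (0, y), hy⟩

theorem isClosed_feasible (h : IsClosed Y) : IsClosed (feasible d Y) :=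
  h.preimage (by fun_prop)

theorem convex_feasible (h : Convex ℝ Y) : Convex ℝ (feasible d Y) := fun _ hz _ hw _ _ ha hb hab =>
  h hz hw ha hb hab

/-- The proximal step of the algorithm is a projected step in `ℝ^(d+d')`. -/
theorem toLp_prox (hne : Y.Nonempty) (hc : IsClosed Y) (hconv : Convex ℝ Y) (a g : E d × E d') :
    WithLp.toLp 2 (prox Y a g) = proj (feasible d Y) (WithLp.toLp 2 a - WithLp.toLp 2 g) := by
  have hobj : ∀ z : E d × E d', proxObj a g z
      = ‖WithLp.toLp 2 a - WithLp.toLp 2 g - WithLp.toLp 2 z‖ ^ 2 / 2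
        + (inner ℝ g.1 a.1 + inner ℝ g.2 a.2 - ‖g.1‖ ^ 2 / 2 - ‖g.2‖ ^ 2 / 2) := fun z => by
    rw [WithLp.prod_norm_sq_eq_of_L2]
    simp only [proxObj, WithLp.sub_fst, WithLp.sub_snd, WithLp.toLp_fst, WithLp.toLp_snd]
    rw [sub_right_comm a.1, sub_right_comm a.2, norm_sub_sq_real (a.1 - z.1),
      norm_sub_sq_real (a.2 - z.2), norm_sub_rev a.1, norm_sub_rev a.2, real_inner_comm g.1,
      real_inner_comm g.2]
    simp only [inner_sub_right]
    ring
  obtain ⟨z, hz, h⟩ := exists_norm_eq_iInf_of_complete_convex (feasible_nonempty (d := d) hne)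
    (isClosed_feasible hc).isComplete (convex_feasible hconv) (WithLp.toLp 2 a - WithLp.toLp 2 g)
  have hex : ∃ z : E d × E d', z.2 ∈ Y ∧ ∀ w : E d × E d', w.2 ∈ Y →
      proxObj a g z ≤ proxObj a g w := by
    refine ⟨WithLp.ofLp z, hz, fun w hw => ?_⟩
    rw [hobj, hobj]
    gcongr
    change ‖WithLp.toLp 2 a - WithLp.toLp 2 g - z‖ ≤ _
    rw [h]
    exact ciInf_le ⟨0, by rintro _ ⟨w, rfl⟩; positivity⟩ (⟨WithLp.toLp 2 w, hw⟩ : feasible d Y)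
  obtain ⟨h1, h2⟩ := Classical.epsilon_spec hex
  change (prox Y a g).2 ∈ Y at h1
  change ∀ w : E d × E d', w.2 ∈ Y → proxObj a g (prox Y a g) ≤ _ at h2
  have hmem : WithLp.toLp 2 (prox Y a g) ∈ feasible d Y := h1
  refine (proj_eq hmem ((norm_eq_iInf_iff_real_inner_le_zero (convex_feasible hconv) hmem).1 ?_)).symm
  have : Nonempty (feasible d Y) := (feasible_nonempty hne).to_subtype
  refine le_antisymm (le_ciInf fun w => ?_)
    (ciInf_le ⟨0, by rintro _ ⟨w, rfl⟩; positivity⟩ (⟨_, hmem⟩ : feasible d Y))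
  have h3 := h2 (WithLp.ofLp (w : H d d')) w.2
  rw [hobj, hobj] at h3
  have h4 : ‖WithLp.toLp 2 a - WithLp.toLp 2 g - WithLp.toLp 2 (prox Y a g)‖ ^ 2
    ≤ ‖WithLp.toLp 2 a - WithLp.toLp 2 g - (w : H d d')‖ ^ 2 := by
    change _ ≤ ‖WithLp.toLp 2 a - WithLp.toLp 2 g - WithLp.toLp 2 (WithLp.ofLp (w : H d d'))‖ ^ 2
    linarith
  exact (pow_le_pow_iff_left₀ (norm_nonneg _) (norm_nonneg _) two_ne_zero).1 h4

end Product

end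

/-! ### Samples, noise and independence -/

section

section Past

variable {Ω Ξ : Type*} [MeasurableSpace Ξ]

/-- The information before sample `t` of stage `k`: all samples of earlier stages, and the samples
`0, …, t - 1` of stage `k`. -/
abbrev past (ξ : ℕ → ℕ → Ω → Ξ) (k t : ℕ) : MeasurableSpace Ω :=
  ⨆ i ∈ {i : ℕ × ℕ | i.1 < k ∨ i.1 = k ∧ i.2 < t},
    MeasurableSpace.comap (ξ i.1 i.2) inferInstance

variable {ξ : ℕ → ℕ → Ω → Ξ}

theorem past_mono {k t k' t' : ℕ} (h : k < k' ∨ k = k' ∧ t ≤ t') : past ξ k t ≤ past ξ k' t' := by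
  refine biSup_mono fun i hi => ?_
  simp only [Set.mem_ofPred_eq] at *
  omega

theorem measurable_sample (k t : ℕ) : Measurable[past ξ k (t + 1)] (ξ k t) := by
  have h : MeasurableSpace.comap (ξ k t) inferInstance ≤ past ξ k (t + 1) :=
    le_iSup₂_of_le (f := fun (i : ℕ × ℕ) (_ : i ∈ {i : ℕ × ℕ | i.1 < k ∨ i.1 = k ∧ i.2 < t + 1}) =>
      MeasurableSpace.comap (ξ i.1 i.2) inferInstance) (k, t) (by simp) le_rfl
  exact measurable_iff_comap_le.2 h

variable [mΩ : MeasurableSpace Ω] {Pr : Measure Ω}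

theorem past_le (hξ : ∀ k t, Measurable (ξ k t)) (k t : ℕ) : past ξ k t ≤ mΩ :=
  iSup₂_le fun i _ => (hξ i.1 i.2).comap_le

theorem indepFun_of_past (hξ : ∀ k t, Measurable (ξ k t))
    (hind : iIndepFun (fun i : ℕ × ℕ => ξ i.1 i.2) Pr) {β : Type*} [MeasurableSpace β]
    {U : Ω → β} {k t : ℕ} (hU : Measurable[past ξ k t] U) : IndepFun U (ξ k t) Pr := by
  have h1 := indep_iSup_of_disjoint (fun i : ℕ × ℕ => (hξ i.1 i.2).comap_le) hind
    (S := {i : ℕ × ℕ | i.1 < k ∨ i.1 = k ∧ i.2 < t}) (T := {(k, t)}) (by simp)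
  rw [IndepFun_iff_Indep]
  refine indep_of_indep_of_le_left (indep_of_indep_of_le_right h1 ?_) hU.comap_le
  simp

end Past

section Noise

variable {Ω Ξ : Type*} [MeasurableSpace Ξ] [MeasurableSpace Ω] {Pr : Measure Ω}
  [IsProbabilityMeasure Pr] {ν : Measure Ξ} [IsProbabilityMeasure ν]

/-- For `U` independent of the sample `X`, bounds on `φ (u, X)` for fixed `u` carry over to
`φ (U, X)`. -/
theorem integrable_comp_of_indepFun {β : Type*} [MeasurableSpace β] {φ : β × Ξ → ℝ}
    (hφ : Measurable φ) (hφ0 : ∀ p, 0 ≤ φ p) {U : Ω → β} {X : Ω → Ξ} (hU : Measurable U)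
    (hX : Measurable X) (hν : Measure.map X Pr = ν) (hUX : IndepFun U X Pr) {c : ℝ} (hc : 0 ≤ c)
    (hint : ∀ ω, Integrable (fun s => φ (U ω, s)) ν) (hle : ∀ ω, ∫ s, φ (U ω, s) ∂ν ≤ c) :
    Integrable (fun ω => φ (U ω, X ω)) Pr ∧ ∫ ω, φ (U ω, X ω) ∂Pr ≤ c := by
  have h1 : ∫⁻ ω, ENNReal.ofReal (φ (U ω, X ω)) ∂Pr ≤ ENNReal.ofReal c := by
    have h2 := hUX.map_prod_eq_prod_map_map hU.aemeasurable hX.aemeasurable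
    have h3 : ∫⁻ ω, ENNReal.ofReal (φ (U ω, X ω)) ∂Pr
        = ∫⁻ p, ENNReal.ofReal (φ p) ∂(Measure.map (fun ω => (U ω, X ω)) Pr) :=
      (lintegral_map hφ.ennreal_ofReal (hU.prodMk hX)).symm
    rw [h3, h2, hν, lintegral_prod _ hφ.ennreal_ofReal.aemeasurable,
      lintegral_map hφ.ennreal_ofReal.lintegral_prod_right' hU]
    calc _ ≤ ∫⁻ _, ENNReal.ofReal c ∂Pr := lintegral_mono fun ω => by
          rw [← ofReal_integral_eq_lintegral_ofReal (hint ω) (Filter.Eventually.of_forall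
            fun s => hφ0 _)]
          exact ENNReal.ofReal_le_ofReal (hle ω)
      _ = _ := by simp
  have hmeas : AEStronglyMeasurable (fun ω => φ (U ω, X ω)) Pr :=
    (hφ.comp (hU.prodMk hX)).aestronglyMeasurable
  refine ⟨⟨hmeas, ?_⟩, ?_⟩
  · rw [hasFiniteIntegral_iff_ofReal (Filter.Eventually.of_forall fun ω => hφ0 _)]
    exact h1.trans_lt ENNReal.ofReal_lt_top
  · rw [integral_eq_lintegral_of_nonneg_ae (Filter.Eventually.of_forall fun ω => hφ0 _) hmeas]
    exact ENNReal.toReal_le_of_le_ofReal hc h1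

variable {F : Type*} [NormedAddCommGroup F] [InnerProductSpace ℝ F] [MeasurableSpace F]
  [BorelSpace F] [SecondCountableTopology F] {S : Set F} {N : F × Ξ → F} {v : ℝ}

omit [InnerProductSpace ℝ F] in
/-- Noise evaluated at a random point that is independent of the sample is square integrable. -/
theorem noise_memLp (hN : Measurable N) (hv : 0 ≤ v)
    (hint : ∀ z ∈ S, Integrable (fun s => ‖N (z, s)‖ ^ 2) ν)
    (hvar : ∀ z ∈ S, ∫ s, ‖N (z, s)‖ ^ 2 ∂ν ≤ v) {U : Ω → F} {X : Ω → Ξ} (hU : Measurable U)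
    (hX : Measurable X) (hν : Measure.map X Pr = ν) (hUX : IndepFun U X Pr) (hUS : ∀ ω, U ω ∈ S) :
    MemLp (fun ω => N (U ω, X ω)) 2 Pr ∧ ∫ ω, ‖N (U ω, X ω)‖ ^ 2 ∂Pr ≤ v := by
  have h1 := integrable_comp_of_indepFun (φ := fun p => ‖N p‖ ^ 2) (hN.norm.pow_const 2)
    (fun p => by positivity) hU hX hν hUX hv (fun ω => hint _ (hUS ω)) (fun ω => hvar _ (hUS ω))
  exact ⟨(memLp_two_iff_integrable_sq_norm
    (hN.comp (hU.prodMk hX)).aestronglyMeasurable).2 h1.1, h1.2⟩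

/-- Centered noise is orthogonal to everything that is independent of the sample. -/
theorem integral_inner_noise (hN : Measurable N)
    (hmean : ∀ z ∈ S, ∀ c, ∫ s, inner ℝ (N (z, s)) c ∂ν = 0) {U V : Ω → F} {X : Ω → Ξ}
    (hU : Measurable U) (hV : Measurable V)
    (hX : Measurable X) (hν : Measure.map X Pr = ν) (hUX : IndepFun (fun ω => (U ω, V ω)) X Pr)
    (hUS : ∀ ω, U ω ∈ S) (hint : Integrable (fun ω => inner ℝ (N (U ω, X ω)) (V ω)) Pr) :
    ∫ ω, inner ℝ (N (U ω, X ω)) (V ω) ∂Pr = 0 := by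
  have hUV : Measurable fun ω => (U ω, V ω) := hU.prodMk hV
  have h2 := hUX.map_prod_eq_prod_map_map hUV.aemeasurable hX.aemeasurable
  set ψ : (F × F) × Ξ → ℝ := fun p => inner ℝ (N (p.1.1, p.2)) p.1.2 with hψ
  have hψm : Measurable ψ :=
    (hN.comp (measurable_fst.fst.prodMk measurable_snd)).inner measurable_fst.snd
  have h3 : ∫ ω, inner ℝ (N (U ω, X ω)) (V ω) ∂Pr
      = ∫ p, ψ p ∂(Measure.map (fun ω => ((U ω, V ω), X ω)) Pr) :=
    (integral_map (hUV.prodMk hX).aemeasurable hψm.aestronglyMeasurable).symm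
  have h4 : Integrable ψ (Measure.map (fun ω => ((U ω, V ω), X ω)) Pr) :=
    (integrable_map_measure hψm.aestronglyMeasurable (hUV.prodMk hX).aemeasurable).2 hint
  rw [h2, hν] at h3 h4
  have : IsProbabilityMeasure (Measure.map (fun ω => (U ω, V ω)) Pr) :=
    Measure.isProbabilityMeasure_map hUV.aemeasurable
  rw [h3, integral_prod _ h4, integral_map hUV.aemeasurable
    hψm.stronglyMeasurable.integral_prod_right.aestronglyMeasurable]
  simp only [hψ]
  simp [fun ω => hmean _ (hUS ω) (V ω)]

omit [MeasurableSpace F] [BorelSpace F] [SecondCountableTopology F] [InnerProductSpace ℝ F] in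
/-- Lipschitz functions grow at most linearly. -/
theorem memLp_comp_of_lipschitz {F' : Type*} [NormedAddCommGroup F'] {φ : F → F'} {c : ℝ}
    (hφ : ∀ z w, ‖φ z - φ w‖ ≤ c * ‖z - w‖) {U : Ω → F} (hU : MemLp U 2 Pr) :
    MemLp (fun ω => φ (U ω)) 2 Pr := by
  have hc : Continuous φ := by
    refine (LipschitzWith.of_dist_le_mul (K := c.toNNReal) fun z w => ?_).continuous
    rw [dist_eq_norm, dist_eq_norm]
    refine (hφ z w).trans ?_
    gcongr
    exact Real.le_coe_toNNReal c
  refine ((memLp_const ‖φ 0‖).add (hU.norm.const_mul c)).mono'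
    (hc.comp_aestronglyMeasurable hU.1) (Filter.Eventually.of_forall fun ω => ?_)
  have h1 := hφ (U ω) 0
  have h2 := norm_add_le (φ (U ω) - φ 0) (φ 0)
  simp only [sub_zero, sub_add_cancel] at h1 h2
  simp only [Pi.add_apply]
  linarith

end Noise

end

/-! ### The regularized gap at the output of a stage -/

section

variable {d d' : ℕ} {Y : Set (E d')} {f : E d → E d' → ℝ} {gy : E d → E d' → E d'}
  {ℓ L ρ μ μx μy : ℝ} {Ξ : Type*}

/-- The mean field `(∇ₓ f, -∇_y f)`. -/
def meanField (f : E d → E d' → ℝ) (gy : E d → E d' → E d') (z : H d d') : H d d' :=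
  WithLp.toLp 2 (gradX f z.fst z.snd, -gy z.fst z.snd)

/-- The stochastic field, as a function of the point and the sample. -/
def stochField (Gx : E d → E d' → Ξ → E d) (Gy : E d → E d' → Ξ → E d') (p : H d d' × Ξ) :
    H d d' :=
  WithLp.toLp 2 (Gx p.1.fst p.1.snd p.2, -Gy p.1.fst p.1.snd p.2)

/-- The noise of the stochastic field. The projection does nothing at feasible points; it extends
the mean field continuously to the whole space. -/
def noise (Y : Set (E d')) (f : E d → E d' → ℝ) (gy : E d → E d' → E d')
    (Gx : E d → E d' → Ξ → E d) (Gy : E d → E d' → Ξ → E d') (p : H d d' × Ξ) : H d d' :=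
  stochField Gx Gy p - meanField f gy (proj (feasible d Y) p.1)

/-- The stochastic error of a stage with iterates `z` and noise `n`, as it appears in
`optimistic_regret_mean`. -/
def residual (z n : ℕ → H d d') (η : ℝ) (T : ℕ) : ℝ :=
  ∑ t ∈ Finset.range T, (3 * η ^ 2 * (‖n (t + 1)‖ ^ 2 + ‖n t‖ ^ 2)
    + η ^ 2 / 2 * ‖n (t + 1)‖ ^ 2
    - η * inner ℝ (n (t + 1)) (z (t + 1) - (z 0 + η • ∑ s ∈ Finset.range t, n (s + 1))))

theorem proj_of_mem {K : Set (H d d')} {z : H d d'} (hz : z ∈ K) : proj K z = z :=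
  proj_eq hz fun w _ => by simp

section Recurrence

variable (hne : Y.Nonempty) (hcl : IsClosed Y) (hconv : Convex ℝ Y)
  (G : E d × E d' → Ξ → E d × E d') (s : ℕ → Ξ) (η : ℝ) (z₀ : E d × E d') (t : ℕ)
include hne hcl hconv

theorem toLp_ogdaState_succ_fst :
    WithLp.toLp 2 (ogdaState Y G s η z₀ (t + 1)).1
      = proj (feasible d Y) (WithLp.toLp 2 (ogdaState Y G s η z₀ t).2
        - η • WithLp.toLp 2 (G (ogdaState Y G s η z₀ t).1 (s t))) := by
  rw [ogdaState, toLp_prox hne hcl hconv, WithLp.toLp_smul]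

theorem toLp_ogdaState_succ_snd :
    WithLp.toLp 2 (ogdaState Y G s η z₀ (t + 1)).2
      = proj (feasible d Y) (WithLp.toLp 2 (ogdaState Y G s η z₀ t).2
        - η • WithLp.toLp 2 (G (ogdaState Y G s η z₀ (t + 1)).1 (s (t + 1)))) := by
  rw [ogdaState, toLp_prox hne hcl hconv, WithLp.toLp_smul]

theorem ogdaState_mem (hz₀ : z₀.2 ∈ Y) : (ogdaState Y G s η z₀ t).1.2 ∈ Y := by
  cases t with
  | zero => exact hz₀
  | succ t =>
    have h := (proj_spec (feasible_nonempty hne) (isClosed_feasible hcl)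
      (convex_feasible hconv) (WithLp.toLp 2 (ogdaState Y G s η z₀ t).2
        - η • WithLp.toLp 2 (G (ogdaState Y G s η z₀ t).1 (s t)))).1
    rwa [← toLp_ogdaState_succ_fst hne hcl hconv] at h

end Recurrence

theorem sum_Icc_one_eq_sum_range {M : Type*} [AddCommMonoid M] (g : ℕ → M) (T : ℕ) :
    ∑ t ∈ Finset.Icc 1 T, g t = ∑ t ∈ Finset.range T, g (t + 1) := by
  induction T with
  | zero => simp
  | succ T ih => rw [Finset.sum_Icc_succ_top (by omega), Finset.sum_range_succ, ih]

theorem ogda_mem (hne : Y.Nonempty) (hcl : IsClosed Y) (hconv : Convex ℝ Y)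
    (G : E d × E d' → Ξ → E d × E d') (s : ℕ → Ξ) (η : ℝ) {T : ℕ} (hT : 0 < T) {z₀ : E d × E d'}
    (hz₀ : z₀.2 ∈ Y) : (ogda Y G s η T z₀).2 ∈ Y := by
  have h : (ogda Y G s η T z₀).2
      = ∑ t ∈ Finset.Icc 1 T, (T : ℝ)⁻¹ • (ogdaState Y G s η z₀ t).1.2 := by
    simp [ogda, Prod.snd_sum, Finset.smul_sum]
  rw [h]
  refine hconv.sum_mem (fun _ _ => by positivity) ?_
    (fun t _ => ogdaState_mem hne hcl hconv G s η z₀ t hz₀)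
  simp [hT.ne']

namespace IsMinMaxProblem

variable (hf : IsMinMaxProblem Y f gy ℓ L ρ μ μx μy)
include hf

theorem norm_meanField_sub_le (hℓ : 0 ≤ ℓ) {z w : H d d'} (hz : z ∈ feasible d Y)
    (hw : w ∈ feasible d Y) : ‖meanField f gy z - meanField f gy w‖ ≤ ℓ * ‖z - w‖ := by
  refine le_of_sq_le_sq ?_ (by positivity)
  rw [mul_pow, WithLp.prod_norm_sq_eq_of_L2, WithLp.prod_norm_sq_eq_of_L2 (z - w)]
  have h := hf.lipschitz z.fst w.fst z.snd hz w.snd hw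
  simp only [meanField, WithLp.sub_fst, WithLp.sub_snd, WithLp.toLp_fst, WithLp.toLp_snd]
  rw [neg_sub_neg, norm_sub_rev (gy w.fst w.snd)]
  exact h

theorem norm_meanField_proj_sub_le (hℓ : 0 ≤ ℓ) (z w : H d d') :
    ‖meanField f gy (proj (feasible d Y) z) - meanField f gy (proj (feasible d Y) w)‖
      ≤ ℓ * ‖z - w‖ := by
  have h1 := feasible_nonempty (d := d) hf.nonempty
  have h2 := isClosed_feasible (d := d) hf.closed
  have h3 := convex_feasible (d := d) hf.convex
  refine (hf.norm_meanField_sub_le hℓ (proj_spec h1 h2 h3 z).1 (proj_spec h1 h2 h3 w).1).trans ?_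
  gcongr
  exact norm_proj_sub_proj_le h1 h2 h3 z w

/-- The regularized function `f(·, y) + ρ ‖· - r‖²` lies above its tangents. -/
theorem reg_convex (hρ : 0 < ρ) (r x u : E d) {y : E d'} (hy : y ∈ Y) :
    f u y + ρ * ‖u - r‖ ^ 2 + inner ℝ (gradX f u y + (2 * ρ) • (u - r)) (x - u)
      ≤ f x y + ρ * ‖x - r‖ ^ 2 := by
  have h1 := (hf.weaklyConvex y hy).2 x u
  change inner ℝ (gradX f u y) (x - u) - _ ≤ _ at h1
  have h2 : ‖x - r‖ ^ 2 = ‖x - u‖ ^ 2 + 2 * inner ℝ (x - u) (u - r) + ‖u - r‖ ^ 2 := by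
    rw [← norm_add_sq_real, sub_add_sub_cancel]
  rw [h2, inner_add_left, real_inner_smul_left, real_inner_comm (x - u) (u - r)]
  have h3 : 0 ≤ ρ * ‖x - u‖ ^ 2 := by positivity
  linarith

theorem saddle_le_inner (hρ : 0 < ρ) (hμy : 0 < μy) (r x u : E d) {y v : E d'} (hy : y ∈ Y)
    (hv : v ∈ Y) :
    f x v + ρ * ‖x - r‖ ^ 2 - (f u y + ρ * ‖u - r‖ ^ 2)
      ≤ inner ℝ (gradX f x y + (2 * ρ) • (x - r)) (x - u) + inner ℝ (-gy x y) (y - v) := by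
  have h1 := hf.reg_convex hρ r u x hy
  have h2 := hf.le_add_inner_gy x hy hv
  have h3 : u - x = -(x - u) := by abel
  have h4 : v - y = -(y - v) := by abel
  have h5 : 0 ≤ μy / 2 * ‖v - y‖ ^ 2 := by positivity
  rw [h3, inner_neg_right] at h1
  rw [h4, inner_neg_right, norm_neg] at h2
  rw [h4, norm_neg] at h5
  rw [inner_neg_left]
  linarith

/-- Jensen's inequality for the regularized function, which is convex-concave. -/
theorem mul_saddle_le_sum (hρ : 0 < ρ) (hμy : 0 < μy) (r u : E d) {v : E d'} (hv : v ∈ Y) {T : ℕ}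
    (hT : 0 < T) (x : ℕ → E d) (y : ℕ → E d') (hy : ∀ t, y t ∈ Y)
    (hyb : (T : ℝ)⁻¹ • ∑ t ∈ Finset.range T, y t ∈ Y) :
    T * (f ((T : ℝ)⁻¹ • ∑ t ∈ Finset.range T, x t) v
        + ρ * ‖(T : ℝ)⁻¹ • ∑ t ∈ Finset.range T, x t - r‖ ^ 2
        - (f u ((T : ℝ)⁻¹ • ∑ t ∈ Finset.range T, y t) + ρ * ‖u - r‖ ^ 2))
      ≤ ∑ t ∈ Finset.range T, (f (x t) v + ρ * ‖x t - r‖ ^ 2 - (f u (y t) + ρ * ‖u - r‖ ^ 2)) := by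
  set xb := (T : ℝ)⁻¹ • ∑ t ∈ Finset.range T, x t with hxb
  set yb := (T : ℝ)⁻¹ • ∑ t ∈ Finset.range T, y t with hyb'
  have hT' : (T : ℝ) ≠ 0 := by positivity
  have hx0 : ∑ t ∈ Finset.range T, (x t - xb) = 0 := by
    rw [Finset.sum_sub_distrib, Finset.sum_const, Finset.card_range, ← Nat.cast_smul_eq_nsmul ℝ,
      hxb, smul_smul, mul_inv_cancel₀ hT', one_smul, sub_self]
  have hy0 : ∑ t ∈ Finset.range T, (y t - yb) = 0 := by
    rw [Finset.sum_sub_distrib, Finset.sum_const, Finset.card_range, ← Nat.cast_smul_eq_nsmul ℝ,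
      hyb', smul_smul, mul_inv_cancel₀ hT', one_smul, sub_self]
  have h1 : ∑ t ∈ Finset.range T, (f xb v + ρ * ‖xb - r‖ ^ 2
        + inner ℝ (gradX f xb v + (2 * ρ) • (xb - r)) (x t - xb)
        - (f u yb + inner ℝ (gy u yb) (y t - yb) + ρ * ‖u - r‖ ^ 2))
      ≤ ∑ t ∈ Finset.range T, (f (x t) v + ρ * ‖x t - r‖ ^ 2 - (f u (y t) + ρ * ‖u - r‖ ^ 2)) := by
    refine Finset.sum_le_sum fun t _ => ?_
    have h2 := hf.reg_convex hρ r (x t) xb hv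
    have h3 := hf.le_add_inner_gy u hyb (hy t)
    have h4 : 0 ≤ μy / 2 * ‖y t - yb‖ ^ 2 := by positivity
    linarith
  refine le_trans (le_of_eq ?_) h1
  simp only [Finset.sum_sub_distrib, Finset.sum_add_distrib, ← inner_sum, hx0, hy0,
    inner_zero_right, Finset.sum_const, Finset.card_range, nsmul_eq_mul]
  ring

end IsMinMaxProblem

/-- The deterministic part of the analysis of one stage: the gap at the output is bounded by the
gaps at both ends, with a small factor, and the stochastic error. -/
theorem regGap_ogda_le (hf : IsMinMaxProblem Y f gy ℓ L ρ μ μx μy) (hρ : 0 < ρ) (hρℓ : ρ ≤ ℓ)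
    (hμy : 0 < μy) (Gx : E d → E d' → Ξ → E d) (Gy : E d → E d' → Ξ → E d') (s : ℕ → Ξ)
    {η : ℝ} (hη : 0 < η) (hηℓ : η * ℓ ≤ 1 / 16) {T : ℕ} (hT : 0 < T) {z₀ : E d × E d'}
    (hz₀ : z₀.2 ∈ Y) {st : ℕ → (E d × E d') × (E d × E d')}
    (hst : st = ogdaState Y (regField Gx Gy (2 * ρ) z₀.1) s η z₀) {zb : E d × E d'}
    (hzb : zb = ogda Y (regField Gx Gy (2 * ρ) z₀.1) s η T z₀) :
    regGap Y f ρ z₀.1 zb.1 zb.2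
      ≤ 2 * (η * T)⁻¹ / min ρ μy * (regGap Y f ρ z₀.1 z₀.1 z₀.2 + regGap Y f ρ z₀.1 zb.1 zb.2)
        + (η * T)⁻¹ * residual (fun t => WithLp.toLp 2 (st t).1)
          (fun t => noise Y f gy Gx Gy (WithLp.toLp 2 (st t).1, s t)) η T := by
  have hT' : (0 : ℝ) < T := by exact_mod_cast hT
  have hzbY : zb.2 ∈ Y := hzb ▸ ogda_mem hf.nonempty hf.closed hf.convex _ s η hT hz₀
  have hstY : ∀ t, (st t).1.2 ∈ Y := fun t => by
    rw [hst]; exact ogdaState_mem hf.nonempty hf.closed hf.convex _ s η z₀ t hz₀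
  have hfe : ∀ t, WithLp.toLp 2 (st t).1 ∈ feasible d Y := hstY
  have hzb1 : zb.1 = (T : ℝ)⁻¹ • ∑ t ∈ Finset.range T, (st (t + 1)).1.1 := by
    rw [hzb, ogda, sum_Icc_one_eq_sum_range, hst]; simp [Prod.fst_sum]
  have hzb2 : zb.2 = (T : ℝ)⁻¹ • ∑ t ∈ Finset.range T, (st (t + 1)).1.2 := by
    rw [hzb, ogda, sum_Icc_one_eq_sum_range, hst]; simp [Prod.snd_sum]
  have hc := convex_feasible (d := d) hf.convex
  set z : ℕ → H d d' := fun t => WithLp.toLp 2 (st t).1 with hz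
  set n : ℕ → H d d' := fun t => noise Y f gy Gx Gy (z t, s t) with hn
  set g : ℕ → H d d' := fun t => WithLp.toLp 2 (regField Gx Gy (2 * ρ) z₀.1 (st t).1 (s t)) with hg
  -- without its noise, the stochastic field is the field of the regularized problem
  have hgn : ∀ t, g t - n t
      = meanField f gy (z t) + (2 * ρ) • WithLp.toLp 2 ((st t).1.1 - z₀.1, (0 : E d')) := fun t => by
    have hp : proj (feasible d Y) (z t) = z t := proj_of_mem (hfe t)
    have hs : g t = stochField Gx Gy (z t, s t)
        + (2 * ρ) • WithLp.toLp 2 ((st t).1.1 - z₀.1, (0 : E d')) := by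
      refine WithLp.ofLp_injective 2 (Prod.ext ?_ ?_)
      · simp [regField, stochField, hz, hg]
      · simp [regField, stochField, hz, hg]
    simp only [hn, noise, hp, hs]
    abel
  refine hf.regGap_le_of_forall hρ hμy hzbY hz₀ (by positivity) fun u v hv => ?_
  have h1 := optimistic_regret_mean (feasible_nonempty hf.nonempty) (isClosed_feasible hf.closed)
    hc (z := z) (a := fun t => WithLp.toLp 2 (st t).2) (g := g) (n := n) (η := η)
    (Λ := ℓ + 2 * ρ) hη.le (by simp [hz, hst, ogdaState])
    (fun t => by
      simp only [hz, hg, hst]; exact toLp_ogdaState_succ_fst hf.nonempty hf.closed hf.convex _ _ _ _ _)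
    (fun t => by
      simp only [hg, hst]; exact toLp_ogdaState_succ_snd hf.nonempty hf.closed hf.convex _ _ _ _ _)
    (fun t => by
      rw [hgn, hgn, add_sub_add_comm, ← smul_sub, add_mul]
      refine (norm_add_le _ _).trans (add_le_add
        (hf.norm_meanField_sub_le (by linarith) (hfe _) (hfe _)) ?_)
      rw [norm_smul, Real.norm_of_nonneg (by positivity)]
      gcongr
      refine le_of_sq_le_sq ?_ (norm_nonneg _)
      rw [WithLp.prod_norm_sq_eq_of_L2, WithLp.prod_norm_sq_eq_of_L2 (z (t + 1) - z t)]
      simp only [hz, WithLp.sub_fst, WithLp.sub_snd, WithLp.toLp_fst, WithLp.toLp_snd, sub_self,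
        norm_zero, sub_sub_sub_cancel_right]
      nlinarith [sq_nonneg ‖(st (t + 1)).1.2 - (st t).1.2‖])
    (by
      have h2 : η * (ℓ + 2 * ρ) ≤ 3 / 16 := by nlinarith
      have h3 : 0 ≤ η * (ℓ + 2 * ρ) := by
        have : 0 ≤ ℓ := by linarith
        positivity
      nlinarith)
    (w := WithLp.toLp 2 (u, v)) hv T
  have h2 := hf.mul_saddle_le_sum hρ hμy z₀.1 u hv hT (fun t => (st (t + 1)).1.1)
    (fun t => (st (t + 1)).1.2) (fun t => hstY _) (hzb2 ▸ hzbY)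
  rw [← hzb1, ← hzb2] at h2
  have h3 : ∑ t ∈ Finset.range T, η * (f (st (t + 1)).1.1 v + ρ * ‖(st (t + 1)).1.1 - z₀.1‖ ^ 2
        - (f u (st (t + 1)).1.2 + ρ * ‖u - z₀.1‖ ^ 2))
      ≤ ∑ t ∈ Finset.range T, η * inner ℝ (g (t + 1) - n (t + 1))
        (z (t + 1) - WithLp.toLp 2 (u, v)) := by
    refine Finset.sum_le_sum fun t _ => mul_le_mul_of_nonneg_left ?_ hη.le
    refine (hf.saddle_le_inner hρ hμy z₀.1 _ u (hstY (t + 1)) hv).trans (le_of_eq ?_)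
    rw [hgn]
    simp [meanField, hz]
  rw [← Finset.mul_sum] at h3
  have h4 : ‖WithLp.toLp 2 (u, v) - z 0‖ ^ 2 = ‖u - z₀.1‖ ^ 2 + ‖v - z₀.2‖ ^ 2 := by
    rw [WithLp.prod_norm_sq_eq_of_L2]
    simp [hz, hst, ogdaState]
  rw [h4] at h1
  have h5 := (mul_le_mul_of_nonneg_left h2 hη.le).trans (h3.trans h1)
  rw [← mul_assoc, ← le_inv_mul_iff₀ (by positivity), mul_add] at h5
  exact h5

end

/-! ### Measurability, moments and the expected error of a stage -/

section

variable {d d' : ℕ} {Y : Set (E d')} {f : E d → E d' → ℝ} {gy : E d → E d' → E d'}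
  {ℓ L ρ μ μx μy σ : ℝ} {Ξ : Type*} [MeasurableSpace Ξ] {ν : Measure Ξ}
  {Gx : E d → E d' → Ξ → E d} {Gy : E d → E d' → Ξ → E d'}

theorem integrable_inner_of_memLp {Ω F : Type*} [MeasurableSpace Ω] {Pr : Measure Ω}
    [NormedAddCommGroup F] [InnerProductSpace ℝ F] {U V : Ω → F} (hU : MemLp U 2 Pr)
    (hV : MemLp V 2 Pr) : Integrable (fun ω => inner ℝ (U ω) (V ω)) Pr := by
  refine (((memLp_two_iff_integrable_sq_norm hU.1).1 hU).add
    ((memLp_two_iff_integrable_sq_norm hV.1).1 hV)).mono' (hU.1.inner hV.1)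
    (Filter.Eventually.of_forall fun ω => ?_)
  have h1 := norm_inner_le_norm (𝕜 := ℝ) (U ω) (V ω)
  simp only [Pi.add_apply]
  nlinarith [sq_nonneg (‖U ω‖ - ‖V ω‖), sq_nonneg ‖U ω‖, sq_nonneg ‖V ω‖]

theorem IsStochGrad.measurable_stochField (hG : IsStochGrad Y f gy ν Gx Gy σ) :
    Measurable (stochField Gx Gy) := by
  refine (WithLp.measurable_toLp 2 (E d × E d')).comp (Measurable.prodMk ?_ ?_)
  · exact hG.measurable_x.comp
      (((WithLp.measurable_ofLp 2 (E d × E d')).comp measurable_fst).prodMk measurable_snd)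
  · exact (hG.measurable_y.comp
      (((WithLp.measurable_ofLp 2 (E d × E d')).comp measurable_fst).prodMk measurable_snd)).neg

theorem IsMinMaxProblem.continuous_meanField_proj (hf : IsMinMaxProblem Y f gy ℓ L ρ μ μx μy)
    (hℓ : 0 ≤ ℓ) : Continuous fun z => meanField f gy (proj (feasible d Y) z) := by
  refine (LipschitzWith.of_dist_le_mul (K := ⟨ℓ, hℓ⟩) fun z w => ?_).continuous
  rw [dist_eq_norm, dist_eq_norm]
  exact hf.norm_meanField_proj_sub_le hℓ z w

theorem measurable_noise (hf : IsMinMaxProblem Y f gy ℓ L ρ μ μx μy) (hℓ : 0 ≤ ℓ)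
    (hG : IsStochGrad Y f gy ν Gx Gy σ) : Measurable (noise Y f gy Gx Gy) :=
  hG.measurable_stochField.sub ((hf.continuous_meanField_proj hℓ).measurable.comp measurable_fst)

omit [MeasurableSpace Ξ] in
theorem noise_of_mem {z : H d d'} (hz : z ∈ feasible d Y) (s : Ξ) :
    noise Y f gy Gx Gy (z, s) = WithLp.toLp 2 (Gx z.fst z.snd s - gradX f z.fst z.snd,
      -(Gy z.fst z.snd s - gy z.fst z.snd)) := by
  simp only [noise, proj_of_mem hz, stochField, meanField, ← WithLp.toLp_sub, Prod.mk_sub_mk]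
  congr 2
  abel

omit [MeasurableSpace Ξ] in
theorem norm_noise_sq {z : H d d'} (hz : z ∈ feasible d Y) (s : Ξ) :
    ‖noise Y f gy Gx Gy (z, s)‖ ^ 2 = ‖Gx z.fst z.snd s - gradX f z.fst z.snd‖ ^ 2
      + ‖Gy z.fst z.snd s - gy z.fst z.snd‖ ^ 2 := by
  rw [noise_of_mem hz, WithLp.prod_norm_sq_eq_of_L2]
  simp only [WithLp.toLp_fst, WithLp.toLp_snd, norm_neg]

namespace IsStochGrad

variable (hG : IsStochGrad Y f gy ν Gx Gy σ)
include hG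

theorem integrable_norm_noise_sq {z : H d d'} (hz : z ∈ feasible d Y) :
    Integrable (fun s => ‖noise Y f gy Gx Gy (z, s)‖ ^ 2) ν := by
  simp only [norm_noise_sq hz]
  exact (hG.integrable_var_x _ _ hz).add (hG.integrable_var_y _ _ hz)

theorem integral_norm_noise_sq_le {z : H d d'} (hz : z ∈ feasible d Y) :
    ∫ s, ‖noise Y f gy Gx Gy (z, s)‖ ^ 2 ∂ν ≤ 2 * σ ^ 2 := by
  simp only [norm_noise_sq hz]
  rw [integral_add (hG.integrable_var_x _ _ hz) (hG.integrable_var_y _ _ hz)]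
  linarith [hG.var_x z.fst z.snd hz, hG.var_y z.fst z.snd hz]

theorem integral_inner_noise_eq_zero [IsProbabilityMeasure ν] {z : H d d'} (hz : z ∈ feasible d Y) (c : H d d') :
    ∫ s, inner ℝ (noise Y f gy Gx Gy (z, s)) c ∂ν = 0 := by
  have hx : Integrable (fun s => Gx z.fst z.snd s - gradX f z.fst z.snd) ν :=
    (hG.integrable_x _ _ hz).sub (integrable_const _)
  have hy : Integrable (fun s => Gy z.fst z.snd s - gy z.fst z.snd) ν :=
    (hG.integrable_y _ _ hz).sub (integrable_const _)
  have hx0 : ∫ s, (Gx z.fst z.snd s - gradX f z.fst z.snd) ∂ν = 0 := by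
    rw [integral_sub (hG.integrable_x _ _ hz) (integrable_const _), hG.mean_x _ _ hz]
    simp
  have hy0 : ∫ s, (Gy z.fst z.snd s - gy z.fst z.snd) ∂ν = 0 := by
    rw [integral_sub (hG.integrable_y _ _ hz) (integrable_const _), hG.mean_y _ _ hz]
    simp
  have h1 : ∀ s, inner ℝ (noise Y f gy Gx Gy (z, s)) c
      = inner ℝ c.fst (Gx z.fst z.snd s - gradX f z.fst z.snd)
        - inner ℝ c.snd (Gy z.fst z.snd s - gy z.fst z.snd) := fun s => by
    rw [noise_of_mem hz, WithLp.prod_inner_apply]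
    simp only [inner_neg_left, WithLp.fst, WithLp.snd]
    rw [real_inner_comm, real_inner_comm c.ofLp.2, ← sub_eq_add_neg]
  simp only [h1]
  rw [integral_sub (hx.const_inner _) (hy.const_inner _), integral_inner hx, integral_inner hy,
    hx0, hy0]
  simp

end IsStochGrad

section Stage

variable {Ω : Type*} [mΩ : MeasurableSpace Ω] {Pr : Measure Ω} [IsProbabilityMeasure Pr]
  {ξ : ℕ → ℕ → Ω → Ξ} {Z : Ω → E d × E d'} {η : ℝ} {k : ℕ}

/-- The state of stage `k` after `t` steps from the random starting point `Z`. -/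
def stageState (Y : Set (E d')) (Gx : E d → E d' → Ξ → E d) (Gy : E d → E d' → Ξ → E d') (ρ : ℝ)
    (ξ : ℕ → ℕ → Ω → Ξ) (η : ℝ) (Z : Ω → E d × E d') (k t : ℕ) (ω : Ω) :
    (E d × E d') × (E d × E d') :=
  ogdaState Y (regField Gx Gy (2 * ρ) (Z ω).1) (fun j => ξ k j ω) η (Z ω) t

/-- The iterate of a stage in `ℝ^(d+d')`. -/
def stageIter (Y : Set (E d')) (Gx : E d → E d' → Ξ → E d) (Gy : E d → E d' → Ξ → E d') (ρ : ℝ)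
    (ξ : ℕ → ℕ → Ω → Ξ) (η : ℝ) (Z : Ω → E d × E d') (k t : ℕ) (ω : Ω) : H d d' :=
  WithLp.toLp 2 (stageState Y Gx Gy ρ ξ η Z k t ω).1

/-- The noise of a stage. -/
def stageNoise (Y : Set (E d')) (f : E d → E d' → ℝ) (gy : E d → E d' → E d')
    (Gx : E d → E d' → Ξ → E d) (Gy : E d → E d' → Ξ → E d') (ρ : ℝ)
    (ξ : ℕ → ℕ → Ω → Ξ) (η : ℝ) (Z : Ω → E d × E d') (k t : ℕ) (ω : Ω) : H d d' :=
  noise Y f gy Gx Gy (stageIter Y Gx Gy ρ ξ η Z k t ω, ξ k t ω)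

/-- The `x`-component, as an element of `ℝ^(d+d')`. -/
def fstPart (z : H d d') : H d d' := WithLp.toLp 2 (z.fst, 0)

theorem norm_fstPart_sub_le (z w : H d d') : ‖fstPart z - fstPart w‖ ≤ 1 * ‖z - w‖ := by
  rw [one_mul]
  refine le_of_sq_le_sq ?_ (norm_nonneg _)
  rw [WithLp.prod_norm_sq_eq_of_L2, WithLp.prod_norm_sq_eq_of_L2 (z - w)]
  simp only [fstPart, WithLp.sub_fst, WithLp.sub_snd, WithLp.toLp_fst, WithLp.toLp_snd, sub_self,
    norm_zero]
  nlinarith [sq_nonneg ‖z.snd - w.snd‖]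

theorem continuous_fstPart : Continuous (fstPart : H d d' → H d d') := by
  refine (LipschitzWith.of_dist_le_mul (K := 1) fun z w => ?_).continuous
  rw [dist_eq_norm, dist_eq_norm]
  exact norm_fstPart_sub_le z w

omit [MeasurableSpace Ξ] in
theorem toLp_regField (r : E d) (z₀ z : E d × E d') (hr : z₀.1 = r) (s : Ξ) :
    WithLp.toLp 2 (regField Gx Gy (2 * ρ) r z s) = stochField Gx Gy (WithLp.toLp 2 z, s)
      + (2 * ρ) • fstPart (WithLp.toLp 2 z - WithLp.toLp 2 z₀) := by
  subst hr
  refine WithLp.ofLp_injective 2 (Prod.ext ?_ ?_)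
  · simp [regField, stochField, fstPart]
  · simp [regField, stochField, fstPart]

variable (hf : IsMinMaxProblem Y f gy ℓ L ρ μ μx μy) (hℓ : 0 ≤ ℓ)
  (hG : IsStochGrad Y f gy ν Gx Gy σ) (hξ : ∀ k t, Measurable (ξ k t))
  (hν : ∀ k t, Measure.map (ξ k t) Pr = ν) (hind : iIndepFun (fun i : ℕ × ℕ => ξ i.1 i.2) Pr)
  (hZY : ∀ ω, (Z ω).2 ∈ Y) (hZm : Measurable[past ξ k 0] fun ω => WithLp.toLp 2 (Z ω))
  (hZL : MemLp (fun ω => WithLp.toLp 2 (Z ω)) 2 Pr)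

include hf hZY in
omit [MeasurableSpace Ξ] mΩ in
theorem stageIter_mem (t : ℕ) (ω : Ω) : stageIter Y Gx Gy ρ ξ η Z k t ω ∈ feasible d Y :=
  ogdaState_mem hf.nonempty hf.closed hf.convex _ _ _ _ _ (hZY ω)

include hf hG hZm in
omit mΩ in
/-- The iterates of a stage depend on past samples only. -/
theorem measurable_stageIter (t : ℕ) :
    Measurable[past ξ k t] (stageIter Y Gx Gy ρ ξ η Z k t) ∧
      Measurable[past ξ k (t + 1)] fun ω => WithLp.toLp 2 (stageState Y Gx Gy ρ ξ η Z k t ω).2 := by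
  have hproj : Measurable (proj (feasible d Y)) :=
    (continuous_proj (feasible_nonempty hf.nonempty) (isClosed_feasible hf.closed)
      (convex_feasible hf.convex)).measurable
  have hZ : ∀ t, Measurable[past ξ k t] fun ω => WithLp.toLp 2 (Z ω) := fun t =>
    hZm.mono (past_mono (Or.inr ⟨rfl, by omega⟩)) le_rfl
  -- one proximal step with sample `t` from a point `a` that is known before sample `t + 1`
  have hstep : ∀ t, ∀ a u : Ω → H d d', Measurable[past ξ k (t + 1)] a →
      Measurable[past ξ k (t + 1)] u → Measurable[past ξ k (t + 1)] fun ω =>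
        proj (feasible d Y) (a ω - η • (stochField Gx Gy (u ω, ξ k t ω)
          + (2 * ρ) • fstPart (u ω - WithLp.toLp 2 (Z ω)))) := fun t a u ha hu => by
    have h1 := hG.measurable_stochField.comp (hu.prodMk (measurable_sample (ξ := ξ) k t))
    have h2 := continuous_fstPart.measurable.comp (hu.sub (hZ (t + 1)))
    exact hproj.comp (ha.sub ((h1.add (h2.const_smul (2 * ρ))).const_smul η))
  induction t with
  | zero => exact ⟨hZ 0, hZ 1⟩
  | succ t ih =>
    have h1 : Measurable[past ξ k (t + 1)] (stageIter Y Gx Gy ρ ξ η Z k (t + 1)) := by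
      have h2 := hstep t _ _ ih.2 (ih.1.mono (past_mono (Or.inr ⟨rfl, by omega⟩)) le_rfl)
      convert h2 using 2 with ω
      rw [stageIter, stageState, toLp_ogdaState_succ_fst hf.nonempty hf.closed hf.convex,
        toLp_regField _ (Z ω) _ rfl]
      rfl
    refine ⟨h1, ?_⟩
    have h2 := hstep (t + 1) _ _ (ih.2.mono (past_mono (Or.inr ⟨rfl, by omega⟩)) le_rfl)
      (h1.mono (past_mono (Or.inr ⟨rfl, by omega⟩)) le_rfl)
    convert h2 using 2 with ω
    rw [stageState, toLp_ogdaState_succ_snd hf.nonempty hf.closed hf.convex,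
      toLp_regField _ (Z ω) _ rfl]
    rfl

include hf hG hZm hℓ in
omit mΩ in
theorem measurable_stageNoise (t : ℕ) :
    Measurable[past ξ k (t + 1)] (stageNoise Y f gy Gx Gy ρ ξ η Z k t) :=
  (measurable_noise hf hℓ hG).comp (((measurable_stageIter hf hG hZm t).1.mono
    (past_mono (Or.inr ⟨rfl, by omega⟩)) le_rfl).prodMk (measurable_sample (ξ := ξ) k t))

variable [IsProbabilityMeasure ν]
include hf hℓ hG hξ hν hind hZY hZm

theorem memLp_stageNoise (t : ℕ) : MemLp (stageNoise Y f gy Gx Gy ρ ξ η Z k t) 2 Pr ∧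
    ∫ ω, ‖stageNoise Y f gy Gx Gy ρ ξ η Z k t ω‖ ^ 2 ∂Pr ≤ 2 * σ ^ 2 := by
  have hm := (measurable_stageIter (η := η) hf hG hZm t).1
  exact noise_memLp (S := feasible d Y) (measurable_noise hf hℓ hG) (by positivity)
    (fun z hz => hG.integrable_norm_noise_sq hz) (fun z hz => hG.integral_norm_noise_sq_le hz)
    (hm.mono (past_le hξ k t) le_rfl) (hξ k t) (hν k t) (indepFun_of_past hξ hind hm)
    (stageIter_mem hf hZY t)

include hZL

theorem memLp_stageIter (t : ℕ) :
    MemLp (stageIter Y Gx Gy ρ ξ η Z k t) 2 Pr ∧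
      MemLp (fun ω => WithLp.toLp 2 (stageState Y Gx Gy ρ ξ η Z k t ω).2) 2 Pr := by
  have hproj : ∀ z w, ‖proj (feasible d Y) z - proj (feasible d Y) w‖ ≤ 1 * ‖z - w‖ := by
    simpa using norm_proj_sub_proj_le (feasible_nonempty hf.nonempty)
      (isClosed_feasible (d := d) hf.closed) (convex_feasible hf.convex)
  have hstep : ∀ t, ∀ a : Ω → H d d', MemLp a 2 Pr →
      MemLp (stageIter Y Gx Gy ρ ξ η Z k t) 2 Pr → MemLp (fun ω =>
        proj (feasible d Y) (a ω - η • (stochField Gx Gy (stageIter Y Gx Gy ρ ξ η Z k t ω, ξ k t ω)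
          + (2 * ρ) • fstPart (stageIter Y Gx Gy ρ ξ η Z k t ω - WithLp.toLp 2 (Z ω))))) 2 Pr :=
      fun t a ha hu => by
    have h1 : MemLp (fun ω => stochField Gx Gy (stageIter Y Gx Gy ρ ξ η Z k t ω, ξ k t ω)) 2 Pr := by
      have h2 := (memLp_stageNoise (η := η) hf hℓ hG hξ hν hind hZY hZm t).1.add
        (memLp_comp_of_lipschitz (hf.norm_meanField_proj_sub_le hℓ) hu)
      refine h2.ae_eq (Filter.Eventually.of_forall fun ω => ?_)
      simp [stageNoise, noise]
    have h2 := memLp_comp_of_lipschitz norm_fstPart_sub_le (hu.sub hZL)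
    exact memLp_comp_of_lipschitz hproj
      (ha.sub ((h1.add (h2.const_smul (2 * ρ))).const_smul η))
  induction t with
  | zero => exact ⟨hZL, hZL⟩
  | succ t ih =>
    have h1 : MemLp (stageIter Y Gx Gy ρ ξ η Z k (t + 1)) 2 Pr := by
      have h2 := hstep t _ ih.2 ih.1
      convert h2 using 2 with ω
      rw [stageIter, stageState, toLp_ogdaState_succ_fst hf.nonempty hf.closed hf.convex,
        toLp_regField _ (Z ω) _ rfl]
      rfl
    refine ⟨h1, ?_⟩
    have h2 := hstep (t + 1) _ ih.2 h1
    convert h2 using 2 with ω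
    rw [stageState, toLp_ogdaState_succ_snd hf.nonempty hf.closed hf.convex,
      toLp_regField _ (Z ω) _ rfl]
    rfl

/-- The cross terms of the stochastic error have mean zero, and the squares are bounded by the
variance. -/
theorem integral_residual_le (T : ℕ) :
    Integrable (fun ω => residual (fun t => stageIter Y Gx Gy ρ ξ η Z k t ω)
      (fun t => stageNoise Y f gy Gx Gy ρ ξ η Z k t ω) η T) Pr ∧
    ∫ ω, residual (fun t => stageIter Y Gx Gy ρ ξ η Z k t ω)
      (fun t => stageNoise Y f gy Gx Gy ρ ξ η Z k t ω) η T ∂Pr ≤ 13 * η ^ 2 * σ ^ 2 * T := by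
  set z := stageIter Y Gx Gy ρ ξ η Z k with hz
  set n := stageNoise Y f gy Gx Gy ρ ξ η Z k with hn
  have hnL : ∀ t, MemLp (n t) 2 Pr := fun t =>
    (memLp_stageNoise hf hℓ hG hξ hν hind hZY hZm t).1
  have hn2 : ∀ t, Integrable (fun ω => ‖n t ω‖ ^ 2) Pr := fun t =>
    (memLp_two_iff_integrable_sq_norm (hnL t).1).1 (hnL t)
  have hnv : ∀ t, ∫ ω, ‖n t ω‖ ^ 2 ∂Pr ≤ 2 * σ ^ 2 := fun t =>
    (memLp_stageNoise hf hℓ hG hξ hν hind hZY hZm t).2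
  have hzL : ∀ t, MemLp (z t) 2 Pr := fun t =>
    (memLp_stageIter hf hℓ hG hξ hν hind hZY hZm hZL t).1
  set V : ℕ → Ω → H d d' := fun t ω => z (t + 1) ω
    - (z 0 ω + η • ∑ s ∈ Finset.range t, n (s + 1) ω) with hV
  have hVL : ∀ t, MemLp (V t) 2 Pr := fun t =>
    (hzL _).sub ((hzL 0).add ((memLp_finsetSum _ fun s _ => hnL (s + 1)).const_smul η))
  have hzm : ∀ t, Measurable[past ξ k t] (z t) := fun t => (measurable_stageIter hf hG hZm t).1
  have hVm : ∀ t, Measurable[past ξ k (t + 1)] (V t) := fun t => by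
    refine (hzm (t + 1)).sub (((hzm 0).mono (past_mono (Or.inr ⟨rfl, by omega⟩)) le_rfl).add
      (Measurable.const_smul (Finset.measurable_fun_sum _ fun s hs => ?_) η))
    have := Finset.mem_range.1 hs
    exact (measurable_stageNoise hf hℓ hG hZm (s + 1)).mono
      (past_mono (Or.inr ⟨rfl, by omega⟩)) le_rfl
  have hint : ∀ t, Integrable (fun ω => inner ℝ (n (t + 1) ω) (V t ω)) Pr := fun t =>
    integrable_inner_of_memLp (hnL _) (hVL t)
  have h0 : ∀ t, ∫ ω, inner ℝ (n (t + 1) ω) (V t ω) ∂Pr = 0 := fun t =>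
    integral_inner_noise (S := feasible d Y) (measurable_noise hf hℓ hG)
      (fun z hz c => hG.integral_inner_noise_eq_zero hz c)
      ((hzm (t + 1)).mono (past_le hξ _ _) le_rfl) ((hVm t).mono (past_le hξ _ _) le_rfl)
      (hξ k (t + 1)) (hν k (t + 1))
      (indepFun_of_past hξ hind ((hzm (t + 1)).prodMk (hVm t)))
      (stageIter_mem hf hZY (t + 1)) (hint t)
  have hi1 : ∀ t, Integrable (fun ω => 3 * η ^ 2 * (‖n (t + 1) ω‖ ^ 2 + ‖n t ω‖ ^ 2)) Pr :=
    fun t => ((hn2 _).add (hn2 _)).const_mul _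
  have hi2 : ∀ t, Integrable (fun ω => η ^ 2 / 2 * ‖n (t + 1) ω‖ ^ 2) Pr :=
    fun t => (hn2 _).const_mul _
  have hi3 : ∀ t, Integrable (fun ω => η * inner ℝ (n (t + 1) ω) (V t ω)) Pr :=
    fun t => (hint _).const_mul _
  have hi : ∀ t, Integrable (fun ω => 3 * η ^ 2 * (‖n (t + 1) ω‖ ^ 2 + ‖n t ω‖ ^ 2)
      + η ^ 2 / 2 * ‖n (t + 1) ω‖ ^ 2 - η * inner ℝ (n (t + 1) ω) (V t ω)) Pr :=
    fun t => ((hi1 t).add (hi2 t)).sub (hi3 t)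
  refine ⟨integrable_finsetSum _ fun t _ => hi t, ?_⟩
  simp only [residual]
  rw [integral_finsetSum _ fun t _ => hi t]
  have hle : ∀ t, ∫ ω, (3 * η ^ 2 * (‖n (t + 1) ω‖ ^ 2 + ‖n t ω‖ ^ 2)
      + η ^ 2 / 2 * ‖n (t + 1) ω‖ ^ 2 - η * inner ℝ (n (t + 1) ω) (V t ω)) ∂Pr
      ≤ 13 * η ^ 2 * σ ^ 2 := fun t => by
    have hi12 : Integrable (fun ω => 3 * η ^ 2 * (‖n (t + 1) ω‖ ^ 2 + ‖n t ω‖ ^ 2)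
        + η ^ 2 / 2 * ‖n (t + 1) ω‖ ^ 2) Pr := (hi1 t).add (hi2 t)
    rw [integral_sub hi12 (hi3 t), integral_add (hi1 t) (hi2 t),
      integral_const_mul, integral_const_mul, integral_const_mul,
      integral_add (hn2 _) (hn2 _), h0]
    nlinarith [hnv t, hnv (t + 1), sq_nonneg η]
  calc _ ≤ ∑ t ∈ Finset.range T, 13 * η ^ 2 * σ ^ 2 := Finset.sum_le_sum fun t _ => hle t
    _ = _ := by simp; ring

end Stage

end

/-! ### Expectation of the regularized gap -/

section

variable {d d' : ℕ} {Y : Set (E d')} {f : E d → E d' → ℝ} {gy : E d → E d' → E d'}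
  {ℓ L ρ μ μx μy σ : ℝ} {Ω : Type*} [mΩ : MeasurableSpace Ω] {Pr : Measure Ω}
  [IsProbabilityMeasure Pr]

omit [IsProbabilityMeasure Pr] in
/-- An infimum over `ℝ^d` of functions that are continuous in the parameter is measurable, since
it can be taken over a countable dense set. -/
theorem measurable_iInf_of_continuous {g : E d → Ω → ℝ} (hc : ∀ ω, Continuous fun u => g u ω)
    (hm : ∀ u, Measurable (g u)) : Measurable fun ω => ⨅ u, g u ω := by
  obtain ⟨S, hS, hd⟩ := TopologicalSpace.exists_countable_dense (E d)
  have : Countable S := hS.to_subtype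
  have h : (fun ω => ⨅ u, g u ω) = fun ω => ⨅ u : S, g u ω :=
    funext fun ω => (hd.ciInf' (hc ω)).symm
  rw [h]
  exact Measurable.iInf fun u => hm u

/-- A random point of `ℝ^d × Y` with finite second moment. -/
structure IsL2Point (Y : Set (E d')) (Pr : Measure Ω) (Z : Ω → E d × E d') : Prop where
  measurable : Measurable fun ω => WithLp.toLp 2 (Z ω)
  memLp : MemLp (fun ω => WithLp.toLp 2 (Z ω)) 2 Pr
  mem : ∀ ω, (Z ω).2 ∈ Y

namespace IsL2Point

variable {Z Z' : Ω → E d × E d'} (hZ : IsL2Point Y Pr Z)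
include hZ

omit [IsProbabilityMeasure Pr] in
theorem measurable_fst : Measurable fun ω => (Z ω).1 :=
  Measurable.fst ((WithLp.measurable_ofLp 2 (E d × E d')).comp hZ.measurable)

omit [IsProbabilityMeasure Pr] in
theorem measurable_snd : Measurable fun ω => (Z ω).2 :=
  Measurable.snd ((WithLp.measurable_ofLp 2 (E d × E d')).comp hZ.measurable)

omit [IsProbabilityMeasure Pr] in
theorem measurable_apply (hf : IsMinMaxProblem Y f gy ℓ L ρ μ μx μy) (u : E d) :
    Measurable fun ω => f u (Z ω).2 :=
  (continuousOn_iff_continuous_domRestrict.1 (hf.continuousOn_y u)).measurable.comp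
    (hZ.measurable_snd.subtype_mk (h := hZ.mem))

omit [IsProbabilityMeasure Pr] in
theorem measurable_gap (hf : IsMinMaxProblem Y f gy ℓ L ρ μ μx μy) :
    Measurable fun ω => gap Y f (Z ω).1 (Z ω).2 :=
  (hf.smooth.1.continuous.measurable.comp hZ.measurable_fst).sub
    (measurable_iInf_of_continuous (fun ω => hf.continuous_x (hZ.mem ω))
      fun u => hZ.measurable_apply hf u)

omit [IsProbabilityMeasure Pr] hZ in
theorem measurable_regGap (hf : IsMinMaxProblem Y f gy ℓ L ρ μ μx μy) (hZ : IsL2Point Y Pr Z)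
    (hZ' : IsL2Point Y Pr Z') : Measurable fun ω => regGap Y f ρ (Z ω).1 (Z' ω).1 (Z' ω).2 := by
  refine ((hf.smooth.1.continuous.measurable.comp hZ'.measurable_fst).add
    (((hZ'.measurable_fst.sub hZ.measurable_fst).norm.pow_const 2).const_mul ρ)).sub
    (measurable_iInf_of_continuous (fun ω => ?_) fun u => ?_)
  · have := hf.continuous_x (hZ'.mem ω)
    fun_prop
  · exact (hZ'.measurable_apply hf u).add
      (((measurable_const.sub hZ.measurable_fst).norm.pow_const 2).const_mul ρ)

theorem integrable_norm_fst_sub_sq (x : E d) : Integrable (fun ω => ‖(Z ω).1 - x‖ ^ 2) Pr := by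
  have h1 : MemLp (fun ω => WithLp.toLp 2 (Z ω) - WithLp.toLp 2 (x, (0 : E d'))) 2 Pr :=
    hZ.memLp.sub (memLp_const _)
  refine ((memLp_two_iff_integrable_sq_norm h1.1).1 h1).mono'
    ((hZ.measurable_fst.sub_const x).norm.pow_const 2).aestronglyMeasurable
    (Filter.Eventually.of_forall fun ω => ?_)
  rw [WithLp.prod_norm_sq_eq_of_L2, Real.norm_of_nonneg (by positivity)]
  simp only [WithLp.sub_fst, WithLp.toLp_fst]
  exact le_add_of_nonneg_right (by positivity)

omit [IsProbabilityMeasure Pr] hZ in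
theorem integrable_norm_fst_sub_fst_sq (hZ : IsL2Point Y Pr Z) (hZ' : IsL2Point Y Pr Z') :
    Integrable (fun ω => ‖(Z' ω).1 - (Z ω).1‖ ^ 2) Pr := by
  have h1 := hZ'.memLp.sub hZ.memLp
  refine ((memLp_two_iff_integrable_sq_norm h1.1).1 h1).mono'
    ((hZ'.measurable_fst.sub hZ.measurable_fst).norm.pow_const 2).aestronglyMeasurable
    (Filter.Eventually.of_forall fun ω => ?_)
  rw [WithLp.prod_norm_sq_eq_of_L2, Real.norm_of_nonneg (by positivity)]
  simp only [Pi.sub_apply, WithLp.sub_fst, WithLp.toLp_fst]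
  exact le_add_of_nonneg_right (by positivity)

theorem integrable_primal_sub (hf : IsMinMaxProblem Y f gy ℓ L ρ μ μx μy) {xs : E d}
    (hxs : ∀ x, primal Y f xs ≤ primal Y f x) :
    Integrable (fun ω => primal Y f (Z ω).1 - primal Y f xs) Pr := by
  refine ((hZ.integrable_norm_fst_sub_sq xs).const_mul (L / 2 + 1 / 2) |>.add
    (integrable_const (‖gradient (primal Y f) xs‖ ^ 2 / 2))).mono'
    ((hf.smooth.1.continuous.measurable.comp hZ.measurable_fst).sub_const _).aestronglyMeasurable
    (Filter.Eventually.of_forall fun ω => ?_)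
  rw [Real.norm_of_nonneg (sub_nonneg.2 (hxs _))]
  have h1 := hf.smooth.le_add_inner xs (Z ω).1
  have h2 := real_inner_le_norm (gradient (primal Y f) xs) ((Z ω).1 - xs)
  simp only [Pi.add_apply]
  nlinarith [sq_nonneg (‖gradient (primal Y f) xs‖ - ‖(Z ω).1 - xs‖)]

omit hZ in
theorem integrable_regGap (hf : IsMinMaxProblem Y f gy ℓ L ρ μ μx μy) (hρ : 0 < ρ) (hℓ : 0 ≤ ℓ)
    (hμy : 0 < μy) (hZ : IsL2Point Y Pr Z) (hZ' : IsL2Point Y Pr Z') :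
    Integrable (fun ω => regGap Y f ρ (Z ω).1 (Z' ω).1 (Z' ω).2) Pr := by
  obtain ⟨xs, hxs, -⟩ := hf.primalPL
  set W : Ω → H d d' := fun ω => WithLp.toLp 2 ((Z ω).1, (Z' ω).2) with hW
  have hWL : MemLp W 2 Pr := by
    have h1 := (memLp_comp_of_lipschitz norm_fstPart_sub_le (hZ.memLp.sub hZ'.memLp)).add hZ'.memLp
    refine h1.ae_eq (Filter.Eventually.of_forall fun ω => ?_)
    refine WithLp.ofLp_injective 2 (Prod.ext ?_ ?_)
    · simp [hW, fstPart]
    · simp [hW, fstPart]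
  have hmf := memLp_comp_of_lipschitz (hf.norm_meanField_proj_sub_le hℓ) hWL
  have hmf2 := (memLp_two_iff_integrable_sq_norm hmf.1).1 hmf
  refine (((hZ'.integrable_primal_sub hf hxs).add (hmf2.const_mul (1 / (2 * μy)))).add
    (hmf2.const_mul (1 / (2 * ρ))) |>.add
    ((hZ.integrable_norm_fst_sub_fst_sq hZ').const_mul ρ)).mono'
    (measurable_regGap hf hZ hZ').aestronglyMeasurable (Filter.Eventually.of_forall fun ω => ?_)
  rw [Real.norm_of_nonneg (hf.regGap_nonneg hρ hμy _ _ (hZ'.mem ω))]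
  refine (hf.regGap_le_norm_sq hρ hμy _ _ (hZ'.mem ω)).trans ?_
  have hp : proj (feasible d Y) (W ω) = W ω := proj_of_mem (hZ'.mem ω)
  have hn : ‖meanField f gy (proj (feasible d Y) (W ω))‖ ^ 2
      = ‖gradX f (Z ω).1 (Z' ω).2‖ ^ 2 + ‖gy (Z ω).1 (Z' ω).2‖ ^ 2 := by
    rw [hp, WithLp.prod_norm_sq_eq_of_L2]
    simp [meanField, hW]
  simp only [Pi.add_apply, hn, one_div_mul_eq_div]
  have h1 : ‖gy (Z ω).1 (Z' ω).2‖ ^ 2 / (2 * μy) ≤ (‖gradX f (Z ω).1 (Z' ω).2‖ ^ 2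
      + ‖gy (Z ω).1 (Z' ω).2‖ ^ 2) / (2 * μy) := by
    gcongr; exact le_add_of_nonneg_left (by positivity)
  have h2 : ‖gradX f (Z ω).1 (Z' ω).2‖ ^ 2 / (2 * ρ) ≤ (‖gradX f (Z ω).1 (Z' ω).2‖ ^ 2
      + ‖gy (Z ω).1 (Z' ω).2‖ ^ 2) / (2 * ρ) := by
    gcongr; exact le_add_of_nonneg_right (by positivity)
  linarith [hxs (Z ω).1]

end IsL2Point

section Stage

variable {Ξ : Type*} [MeasurableSpace Ξ] {ν : Measure Ξ} [IsProbabilityMeasure ν]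
  {Gx : E d → E d' → Ξ → E d} {Gy : E d → E d' → Ξ → E d'}
  {ξ : ℕ → ℕ → Ω → Ξ} {Z : Ω → E d × E d'} {η : ℝ} {k : ℕ}

omit [MeasurableSpace Ξ] [IsProbabilityMeasure Pr] mΩ in
theorem toLp_ogda (T : ℕ) (ω : Ω) :
    WithLp.toLp 2 (ogda Y (regField Gx Gy (2 * ρ) (Z ω).1) (fun j => ξ k j ω) η T (Z ω))
      = (T : ℝ)⁻¹ • ∑ t ∈ Finset.range T, stageIter Y Gx Gy ρ ξ η Z k (t + 1) ω := by
  rw [ogda, sum_Icc_one_eq_sum_range, WithLp.toLp_smul, WithLp.toLp_sum]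
  rfl

variable (hf : IsMinMaxProblem Y f gy ℓ L ρ μ μx μy) (hℓ : 0 ≤ ℓ)
  (hG : IsStochGrad Y f gy ν Gx Gy σ) (hξ : ∀ k t, Measurable (ξ k t))
  (hν : ∀ k t, Measure.map (ξ k t) Pr = ν) (hind : iIndepFun (fun i : ℕ × ℕ => ξ i.1 i.2) Pr)
  (hZm : Measurable[past ξ k 0] fun ω => WithLp.toLp 2 (Z ω)) (hZ : IsL2Point Y Pr Z)
  {T : ℕ} (hT : 0 < T) {Zb : Ω → E d × E d'}
  (hZb : Zb = fun ω => ogda Y (regField Gx Gy (2 * ρ) (Z ω).1) (fun j => ξ k j ω) η T (Z ω))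
include hf hG hZm hZb

omit [IsProbabilityMeasure ν] mΩ [IsProbabilityMeasure Pr] in
theorem measurable_ogda : Measurable[past ξ (k + 1) 0] fun ω => WithLp.toLp 2 (Zb ω) := by
  simp only [hZb, toLp_ogda]
  have h : Measurable[past ξ (k + 1) 0] fun ω =>
      ∑ t ∈ Finset.range T, stageIter Y Gx Gy ρ ξ η Z k (t + 1) ω :=
    Finset.measurable_fun_sum _ fun t _ =>
      (measurable_stageIter hf hG hZm (t + 1)).1.mono (past_mono (Or.inl (by omega))) le_rfl
  exact h.const_smul (T : ℝ)⁻¹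

include hℓ hξ hν hind hZ hT

theorem isL2Point_ogda : IsL2Point Y Pr Zb where
  measurable := (measurable_ogda hf hG hZm hZb).mono (past_le hξ _ _) le_rfl
  memLp := by
    simp only [hZb, toLp_ogda]
    have h : MemLp (fun ω => ∑ t ∈ Finset.range T, stageIter Y Gx Gy ρ ξ η Z k (t + 1) ω) 2 Pr :=
      memLp_finsetSum _ fun t _ =>
        (memLp_stageIter hf hℓ hG hξ hν hind hZ.mem hZm hZ.memLp (t + 1)).1
    exact h.const_smul (T : ℝ)⁻¹
  mem ω := by
    rw [hZb]
    exact ogda_mem hf.nonempty hf.closed hf.convex _ _ _ hT (hZ.mem ω)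

/-- One stage reduces the expected regularized gap by a constant factor, up to the noise. -/
theorem integral_regGap_ogda_le (hρ : 0 < ρ) (hρℓ : ρ ≤ ℓ) (hμy : 0 < μy) (hη : 0 < η)
    (hηℓ : η * ℓ ≤ 1 / 16) (hηT : 212 ≤ η * T * min ρ μy) :
    ∫ ω, regGap Y f ρ (Z ω).1 (Zb ω).1 (Zb ω).2 ∂Pr
      ≤ 1 / 105 * ∫ ω, regGap Y f ρ (Z ω).1 (Z ω).1 (Z ω).2 ∂Pr + 14 * η * σ ^ 2 := by
  have hZb2 := isL2Point_ogda hf hℓ hG hξ hν hind hZm hZ hT hZb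
  have hT' : (0 : ℝ) < T := by exact_mod_cast hT
  have hm : 0 < min ρ μy := lt_min hρ hμy
  have hGi := IsL2Point.integrable_regGap hf hρ hℓ hμy hZ hZb2
  have hDi := IsL2Point.integrable_regGap hf hρ hℓ hμy hZ hZ
  obtain ⟨hRi, hR⟩ := integral_residual_le (η := η) hf hℓ hG hξ hν hind hZ.mem hZm hZ.memLp T
  have h1 : ∀ ω, regGap Y f ρ (Z ω).1 (Zb ω).1 (Zb ω).2
      ≤ 1 / 106 * (regGap Y f ρ (Z ω).1 (Z ω).1 (Z ω).2 + regGap Y f ρ (Z ω).1 (Zb ω).1 (Zb ω).2)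
        + (η * T)⁻¹ * residual (fun t => stageIter Y Gx Gy ρ ξ η Z k t ω)
          (fun t => stageNoise Y f gy Gx Gy ρ ξ η Z k t ω) η T := fun ω => by
    refine (regGap_ogda_le hf hρ hρℓ hμy Gx Gy (fun j => ξ k j ω) hη hηℓ hT (hZ.mem ω) rfl
      (congrFun hZb ω)).trans ?_
    refine add_le_add (mul_le_mul_of_nonneg_right ?_ (add_nonneg
      (hf.regGap_nonneg hρ hμy _ _ (hZ.mem ω)) (hf.regGap_nonneg hρ hμy _ _ (hZb2.mem ω)))) le_rfl
    rw [← div_eq_mul_inv, div_div, div_le_div_iff₀ (by positivity) (by norm_num)]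
    linarith
  have hDG : Integrable (fun ω => 1 / 106 * (regGap Y f ρ (Z ω).1 (Z ω).1 (Z ω).2
      + regGap Y f ρ (Z ω).1 (Zb ω).1 (Zb ω).2)) Pr := (hDi.add hGi).const_mul _
  have h2 := integral_mono hGi (hDG.add (hRi.const_mul (η * T)⁻¹)) h1
  rw [integral_add' hDG (hRi.const_mul (η * T)⁻¹), integral_const_mul, integral_const_mul,
    integral_add hDi hGi] at h2
  have h3 : (η * T)⁻¹ * ∫ ω, residual (fun t => stageIter Y Gx Gy ρ ξ η Z k t ω)
      (fun t => stageNoise Y f gy Gx Gy ρ ξ η Z k t ω) η T ∂Pr ≤ 13 * η * σ ^ 2 := by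
    rw [inv_mul_le_iff₀ (by positivity)]
    linarith
  have h4 : 0 ≤ η * σ ^ 2 := by positivity
  linarith

end Stage

end

/-! ### The recursion over the stages -/

section

/-- The exponential rate `2μ / (c + 2μ)` of the step sizes and epoch lengths. -/
def rate (L ρ μ : ℝ) : ℝ := 2 * μ / (cConst L ρ + 2 * μ)

section Rate

variable {L ρ μ : ℝ} (hρ : 0 < ρ) (hL : 0 ≤ L) (hμ : 0 < μ)
include hρ hL hμ

omit hμ in
theorem cConst_pos : 0 < cConst L ρ := by unfold cConst; positivity

theorem rate_pos : 0 < rate L ρ μ := by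
  have := cConst_pos hρ hL
  unfold rate; positivity

theorem rate_le_one : rate L ρ μ ≤ 1 := by
  have := cConst_pos hρ hL
  unfold rate
  rw [div_le_one (by positivity)]
  linarith

theorem exp_rate_le : Real.exp (rate L ρ μ) ≤ 3 :=
  (Real.exp_le_exp.2 (rate_le_one hρ hL hμ)).trans (by linarith [Real.exp_one_lt_d9])

end Rate

/-- The decay of a potential that contracts by the factor `1 - α` per stage, when the noise decays
at the rate `α` as well. -/
theorem le_exp_mul_of_contraction {Φ : ℕ → ℝ} {α S : ℝ} (hΦ : ∀ k, 0 ≤ Φ k)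
    (hS : 0 ≤ S) (hα3 : Real.exp α ≤ 3)
    (h : ∀ k : ℕ, Φ (k + 1) ≤ (1 - α) * Φ k + S * Real.exp (-α * k)) (k : ℕ) :
    Φ k ≤ Real.exp (-α * k) * (Φ 0 + 3 * S * k) := by
  induction k with
  | zero => simp
  | succ k ih =>
    have h1 : 1 - α ≤ Real.exp (-α) := by linarith [Real.add_one_le_exp (-α)]
    have h2 : Real.exp (-α * (k + 1 : ℕ)) = Real.exp (-α) * Real.exp (-α * k) := by
      rw [← Real.exp_add]; push_cast; ring_nf
    have h3 : 1 ≤ 3 * Real.exp (-α) := by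
      rw [Real.exp_neg, ← div_eq_mul_inv, one_le_div (Real.exp_pos _)]
      exact hα3
    have h4 := mul_le_mul_of_nonneg_right h1 (hΦ k)
    have h5 := mul_le_mul_of_nonneg_left ih (Real.exp_pos (-α)).le
    have h6 := mul_le_mul_of_nonneg_right h3 (mul_nonneg hS (Real.exp_pos (-α * k)).le)
    rw [h2]
    push_cast
    linarith [h k]

/-- The combination of the stage inequalities for the primal suboptimality `p`, the gap `D` at the
start of a stage and the gap `G` at its end. The potential is `p + (L + 2ρ) / (4 (c + 2μ)) D`. -/
theorem stage_recursion {L ρ μ : ℝ} (hρ : 0 < ρ) (hL : 0 ≤ L) (hμ : 0 < μ) (hμL : μ ≤ L + 2 * ρ)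
    {p D G : ℕ → ℝ} {S : ℝ} (hS : 0 ≤ S) (hp : ∀ k, 0 ≤ p k) (hD : ∀ k, 0 ≤ D k)
    (h1 : ∀ k, (8 * ρ + 2 * μ) * p (k + 1) ≤ 8 * ρ * p k + (4 * (L + 2 * ρ) + 8 * ρ) * G k)
    (h2 : ∀ k, p (k + 1) ≤ p k + G k)
    (h3 : ∀ k, D (k + 1) ≤ 10 * G k + 8 * (p k - p (k + 1)))
    (h4 : ∀ k : ℕ, G k ≤ 1 / 105 * D k + 14 * S * Real.exp (-rate L ρ μ * k)) (k : ℕ) :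
    D k ≤ 36 * (Real.exp (-rate L ρ μ * k) * (p 0 + D 0 + 84 * S * k)) := by
  have hc := cConst_pos hρ hL
  have hα := rate_pos hρ hL hμ
  set Lh := L + 2 * ρ with hLh
  set c := cConst L ρ with hcdef
  have hcv : c = 4 * ρ + 248 / 53 * Lh := rfl
  set b := Lh / (4 * (c + 2 * μ)) with hb
  have hLh0 : 0 < Lh := by positivity
  have hb0 : 0 ≤ b := by positivity
  have hb1 : b * (c + 2 * μ) = Lh / 4 := by rw [hb]; field_simp
  have hρL : 2 * ρ ≤ Lh := by linarith
  have hrate : (1 - rate L ρ μ) * (c + 2 * μ) = c := by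
    rw [rate, ← hcdef]; field_simp; ring
  have hstep : ∀ k : ℕ, p (k + 1) + b * D (k + 1)
      ≤ (1 - rate L ρ μ) * (p k + b * D k) + 28 * S * Real.exp (-rate L ρ μ * k) := fun k => by
    set e := S * Real.exp (-rate L ρ μ * k) with he
    have he0 : 0 ≤ e := by positivity
    -- add `h2` and `h3` with weights that turn the coefficient `8ρ` of `p k` in `h1` into `c`
    have h5 : (c + 2 * μ) * p (k + 1) + Lh / 4 * D (k + 1) ≤ c * p k + (9 / 2 * Lh + c) * G k := by
      have h6 := mul_le_mul_of_nonneg_left (h2 k) (by linarith : 0 ≤ c - 8 * ρ - 2 * Lh)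
      have h7 := mul_le_mul_of_nonneg_left (h3 k) (by linarith : 0 ≤ Lh / 4)
      linarith [h1 k]
    have h6 : (9 / 2 * Lh + c) * G k ≤ (9 / 2 * Lh + c) * (1 / 105 * D k + 14 * e) :=
      mul_le_mul_of_nonneg_left (by rw [he]; linarith [h4 k]) (by positivity)
    -- `c / (c + 2μ) ≥ 2 / 3` leaves room for the gap carried over from the last stage
    have h7 : (9 / 2 * Lh + c) * (1 / 105) ≤ c * b := by
      have h8 : 2 / 3 * (c + 2 * μ) ≤ c := by linarith
      have h9 := mul_le_mul_of_nonneg_left h8 hb0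
      linarith
    have h8 := mul_le_mul_of_nonneg_right h7 (hD k)
    have h9 : (9 / 2 * Lh + c) * (14 * e) ≤ (c + 2 * μ) * (28 * e) := by
      have : 9 / 2 * Lh + c ≤ (c + 2 * μ) * 2 := by linarith
      have := mul_le_mul_of_nonneg_right this (by positivity : 0 ≤ 14 * e)
      linarith
    have h10 : (c + 2 * μ) * (p (k + 1) + b * D (k + 1))
        ≤ (c + 2 * μ) * ((1 - rate L ρ μ) * (p k + b * D k) + 28 * e) := by
      have h11 : (c + 2 * μ) * (p (k + 1) + b * D (k + 1))
          = (c + 2 * μ) * p (k + 1) + Lh / 4 * D (k + 1) := by rw [← hb1]; ring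
      have h12 : (c + 2 * μ) * ((1 - rate L ρ μ) * (p k + b * D k) + 28 * e)
          = c * p k + c * b * D k + (c + 2 * μ) * (28 * e) := by
        rw [mul_add, ← mul_assoc, mul_comm (c + 2 * μ) (1 - _), hrate]; ring
      rw [h11, h12]
      linarith
    have h11 := le_of_mul_le_mul_left h10 (by positivity)
    rw [he] at h11
    linarith
  have h5 := le_exp_mul_of_contraction (Φ := fun k => p k + b * D k) (α := rate L ρ μ)
    (S := 28 * S) (fun k => add_nonneg (hp k) (mul_nonneg hb0 (hD k))) (by positivity)
    (exp_rate_le hρ hL hμ) hstep k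
  have h6 : 1 ≤ 36 * b := by
    rw [hb, ← mul_div_assoc, one_le_div (by positivity)]
    linarith
  have h7 : b ≤ 1 := by
    rw [hb, div_le_one (by positivity)]
    linarith
  have h8 := mul_le_mul_of_nonneg_right h6 (hD k)
  have h9 : Real.exp (-rate L ρ μ * k) * (p 0 + b * D 0 + 3 * (28 * S) * k)
      ≤ Real.exp (-rate L ρ μ * k) * (p 0 + D 0 + 84 * S * k) := by
    refine mul_le_mul_of_nonneg_left ?_ (Real.exp_pos _).le
    have := mul_le_mul_of_nonneg_right h7 (hD 0)
    linarith
  linarith [hp k]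

section Parameters

variable {ℓ L ρ μ μy : ℝ} (hρ : 0 < ρ) (hρℓ : ρ ≤ ℓ) (hL : 0 ≤ L) (hμ : 0 < μ)
  (hμy : 0 < μy)
include hρ hρℓ

omit hρℓ hρ in
theorem stepSize_succ (η₀ : ℝ) (k : ℕ) :
    stepSize η₀ L ρ μ (k + 1) = η₀ * Real.exp (-rate L ρ μ * k) := by
  rw [stepSize, rate]; push_cast; ring_nf

omit hρℓ hρ in
theorem epochLength_succ (η₀ : ℝ) (k : ℕ) :
    epochLength η₀ L ρ μ μy (k + 1) = ⌈212 / (η₀ * min ρ μy) * Real.exp (rate L ρ μ * k)⌉₊ := by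
  rw [epochLength, rate]; push_cast; ring_nf

theorem stepSize_pos (k : ℕ) : 0 < stepSize (1 / 16 / ℓ) L ρ μ k := by
  have : 0 < ℓ := by linarith
  unfold stepSize; positivity

include hμy in
theorem epochLength_pos (k : ℕ) : 0 < epochLength (1 / 16 / ℓ) L ρ μ μy k := by
  have : 0 < ℓ := by linarith
  have : 0 < min ρ μy := lt_min hρ hμy
  rw [epochLength, Nat.ceil_pos]
  positivity

include hL hμ in
theorem stepSize_mul_le (k : ℕ) : stepSize (1 / 16 / ℓ) L ρ μ (k + 1) * ℓ ≤ 1 / 16 := by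
  have hℓ : 0 < ℓ := by linarith
  have h1 : Real.exp (-rate L ρ μ * k) ≤ 1 := by
    rw [Real.exp_le_one_iff, neg_mul, neg_nonpos]
    exact mul_nonneg (rate_pos hρ hL hμ).le (Nat.cast_nonneg k)
  rw [stepSize_succ]
  calc 1 / 16 / ℓ * Real.exp (-rate L ρ μ * k) * ℓ = 1 / 16 * Real.exp (-rate L ρ μ * k) := by
        field_simp
    _ ≤ _ := by linarith

include hμy in
/-- The epochs are long enough for the regret bound to give the factor `1 / 106`. -/
theorem le_stepSize_mul_epochLength (k : ℕ) :
    212 ≤ stepSize (1 / 16 / ℓ) L ρ μ (k + 1) * epochLength (1 / 16 / ℓ) L ρ μ μy (k + 1)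
      * min ρ μy := by
  have hℓ : 0 < ℓ := by linarith
  have hm : 0 < min ρ μy := lt_min hρ hμy
  have h1 := Nat.le_ceil (212 / (1 / 16 / ℓ * min ρ μy) * Real.exp (rate L ρ μ * k))
  rw [← epochLength_succ] at h1
  have h2 := mul_le_mul_of_nonneg_right (mul_le_mul_of_nonneg_left h1
    (stepSize_pos hρ hρℓ (L := L) (μ := μ) (k + 1)).le) hm.le
  refine le_trans (le_of_eq ?_) h2
  rw [stepSize_succ, neg_mul, Real.exp_neg]
  field_simp

end Parameters

section Convergence

variable {d d' : ℕ} {Y : Set (E d')} {f : E d → E d' → ℝ} {gy : E d → E d' → E d'}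
  {ℓ L ρ μ μx μy σ ε₀ : ℝ} {Ω Ξ : Type*} [MeasurableSpace Ω] {Pr : Measure Ω}
  [IsProbabilityMeasure Pr] [MeasurableSpace Ξ] {ν : Measure Ξ} [IsProbabilityMeasure ν]
  {Gx : E d → E d' → Ξ → E d} {Gy : E d → E d' → Ξ → E d'} {ξ : ℕ → ℕ → Ω → Ξ} {z₀ : E d × E d'}

theorem iterate_isL2Point (hf : IsMinMaxProblem Y f gy ℓ L ρ μ μx μy) (hρ : 0 < ρ) (hρℓ : ρ ≤ ℓ)
    (hμy : 0 < μy)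
    (hG : IsStochGrad Y f gy ν Gx Gy σ) (hξ : ∀ k t, Measurable (ξ k t))
    (hν : ∀ k t, Measure.map (ξ k t) Pr = ν) (hind : iIndepFun (fun i : ℕ × ℕ => ξ i.1 i.2) Pr)
    (hz₀ : z₀.2 ∈ Y) (k : ℕ) :
    Measurable[past ξ (k + 1) 0]
        (fun ω => WithLp.toLp 2 (iterate Y Gx Gy ξ (1 / 16 / ℓ) L ρ μ μy z₀ k ω)) ∧
      IsL2Point Y Pr (iterate Y Gx Gy ξ (1 / 16 / ℓ) L ρ μ μy z₀ k) := by
  induction k with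
  | zero =>
    exact ⟨measurable_const (a := WithLp.toLp 2 z₀), measurable_const (a := WithLp.toLp 2 z₀),
      memLp_const (WithLp.toLp 2 z₀), fun _ => hz₀⟩
  | succ k ih => exact ⟨measurable_ogda hf hG ih.1 rfl, isL2Point_ogda hf (by linarith) hG hξ hν hind
      ih.1 ih.2 (epochLength_pos hρ hρℓ hμy _) rfl⟩

/-- Convergence of the expected duality gap at the exponential rate, up to the factor `K` in the
noise term. -/
theorem integral_gap_iterate_le (hf : IsMinMaxProblem Y f gy ℓ L ρ μ μx μy) (hρ : 0 < ρ)
    (hρℓ : ρ ≤ ℓ) (hL : 0 ≤ L) (hμ : 0 < μ) (hμx : 0 < μx) (hμy : 0 < μy)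
    (hG : IsStochGrad Y f gy ν Gx Gy σ) (hξ : ∀ k t, Measurable (ξ k t))
    (hν : ∀ k t, Measure.map (ξ k t) Pr = ν) (hind : iIndepFun (fun i : ℕ × ℕ => ξ i.1 i.2) Pr)
    (hz₀ : z₀.2 ∈ Y) (hε₀ : gap Y f z₀.1 z₀.2 ≤ ε₀) (K : ℕ) {Z : ℕ → Ω → E d × E d'}
    (hZ : Z = iterate Y Gx Gy ξ (1 / 16 / ℓ) L ρ μ μy z₀) :
    Integrable (fun ω => gap Y f (Z K ω).1 (Z K ω).2) Pr ∧
      ∫ ω, gap Y f (Z K ω).1 (Z K ω).2 ∂Pr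
        ≤ 10 ^ 5 * (ρ / μx + 1) * Real.exp (-rate L ρ μ * K) * (ε₀ + σ ^ 2 / ℓ * K) := by
  have hℓ : 0 < ℓ := by linarith
  have hκ : 0 ≤ ρ / μx := by positivity
  have hε₀' : 0 ≤ ε₀ := (hf.gap_nonneg hμy _ hz₀).trans hε₀
  have hZ0 : ∀ ω, Z 0 ω = z₀ := fun ω => by rw [hZ]; rfl
  rcases K with _ | k
  · simp only [hZ0, integral_const, probReal_univ, one_smul]
    refine ⟨integrable_const _, hε₀.trans ?_⟩
    simp only [Nat.cast_zero, mul_zero, Real.exp_zero, mul_one, add_zero]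
    nlinarith
  have hZk : ∀ k, Measurable[past ξ (k + 1) 0] (fun ω => WithLp.toLp 2 (Z k ω)) ∧
      IsL2Point Y Pr (Z k) := fun k => by
    rw [hZ]
    exact iterate_isL2Point hf hρ hρℓ hμy hG hξ hν hind hz₀ k
  have hmem : ∀ k ω, (Z k ω).2 ∈ Y := fun k => (hZk k).2.mem
  obtain ⟨xs, hxs, hPL⟩ := hf.primalPL
  have hpi := fun k => (hZk k).2.integrable_primal_sub hf hxs
  have hDi := fun k => IsL2Point.integrable_regGap hf hρ hℓ.le hμy (hZk k).2 (hZk k).2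
  have hGi := fun k => IsL2Point.integrable_regGap hf hρ hℓ.le hμy (hZk k).2 (hZk (k + 1)).2
  set p : ℕ → ℝ := fun k => ∫ ω, (primal Y f (Z k ω).1 - primal Y f xs) ∂Pr with hp
  set D : ℕ → ℝ := fun k => ∫ ω, regGap Y f ρ (Z k ω).1 (Z k ω).1 (Z k ω).2 ∂Pr with hD
  set G : ℕ → ℝ :=
    fun k => ∫ ω, regGap Y f ρ (Z k ω).1 (Z (k + 1) ω).1 (Z (k + 1) ω).2 ∂Pr with hGdef
  set S : ℝ := 1 / 16 / ℓ * σ ^ 2 with hS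
  have hS0 : 0 ≤ S := by positivity
  have hSle : S ≤ σ ^ 2 / ℓ := by
    have : S = 1 / 16 * (σ ^ 2 / ℓ) := by rw [hS]; ring
    have : 0 ≤ σ ^ 2 / ℓ := by positivity
    linarith
  have hp0 : ∀ k, 0 ≤ p k := fun k => integral_nonneg fun ω => sub_nonneg.2 (hxs _)
  have hD0 : ∀ k, 0 ≤ D k := fun k =>
    integral_nonneg fun ω => hf.regGap_nonneg hρ hμy _ _ (hmem k ω)
  have hG0 : ∀ k, 0 ≤ G k := fun k =>
    integral_nonneg fun ω => hf.regGap_nonneg hρ hμy _ _ (hmem (k + 1) ω)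
  have h1 : ∀ k, (8 * ρ + 2 * μ) * p (k + 1)
      ≤ 8 * ρ * p k + (4 * (L + 2 * ρ) + 8 * ρ) * G k := fun k => by
    have h := integral_mono ((hpi (k + 1)).const_mul (8 * ρ + 2 * μ))
      (((hpi k).const_mul (8 * ρ)).add ((hGi k).const_mul (4 * (L + 2 * ρ) + 8 * ρ)))
      fun ω => hf.primal_decrease hρ hμy hL hPL (Z k ω).1 _ (hmem (k + 1) ω)
    rwa [integral_add' ((hpi k).const_mul (8 * ρ)) ((hGi k).const_mul _), integral_const_mul,
      integral_const_mul, integral_const_mul] at h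
  have h2 : ∀ k, p (k + 1) ≤ p k + G k := fun k => by
    have h := integral_mono (hpi (k + 1)) ((hpi k).add (hGi k)) fun ω => by
      have h3 := hf.mul_norm_sub_sq_le hρ hμy (Z k ω).1 (Z (k + 1) ω).1 (hmem (k + 1) ω)
      have h4 : 0 ≤ ρ * ‖(Z (k + 1) ω).1 - (Z k ω).1‖ ^ 2 := by positivity
      simp only [Pi.add_apply]
      linarith
    rwa [integral_add' (hpi k) (hGi k)] at h
  have h3 : ∀ k, D (k + 1) ≤ 10 * G k + 8 * (p k - p (k + 1)) := fun k => by
    have h := integral_mono (hDi (k + 1)) (((hGi k).const_mul 10).add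
      (((hpi k).sub (hpi (k + 1))).const_mul 8)) fun ω => by
        have h4 := hf.regGap_self_le hρ hμy (Z k ω).1 (Z (k + 1) ω).1 (hmem (k + 1) ω)
        simp only [Pi.add_apply, Pi.sub_apply]
        linarith
    rw [integral_add' ((hGi k).const_mul 10) (((hpi k).sub (hpi (k + 1))).const_mul 8),
      integral_const_mul, integral_const_mul, integral_sub' (hpi k) (hpi (k + 1))] at h
    exact h
  have h4 : ∀ k : ℕ, G k ≤ 1 / 105 * D k + 14 * S * Real.exp (-rate L ρ μ * k) := fun k => by
    have h := integral_regGap_ogda_le (η := stepSize (1 / 16 / ℓ) L ρ μ (k + 1)) hf hℓ.le hG hξ hν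
      hind (hZk k).1 (hZk k).2 (T := epochLength (1 / 16 / ℓ) L ρ μ μy (k + 1))
      (epochLength_pos hρ hρℓ hμy _) (Zb := Z (k + 1)) (by subst hZ; rfl) hρ hρℓ hμy
      (stepSize_pos hρ hρℓ _) (stepSize_mul_le hρ hρℓ hL hμ k)
      (le_stepSize_mul_epochLength hρ hρℓ hμy k)
    rw [stepSize_succ] at h
    refine h.trans (le_of_eq ?_)
    rw [hS]
    ring
  have h5 := stage_recursion hρ hL hμ (hf.mu_le hρ hL) hS0 hp0 hD0 h1 h2 h3 h4 k
  have hinit : p 0 + D 0 ≤ 2 * ε₀ := by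
    have h6 := hf.primal_sub_le_gap hμy z₀.1 xs hz₀
    have h7 := hf.regGap_self_le_gap hρ z₀.1 hz₀
    simp only [hp, hD, hZ0, integral_const, probReal_univ, one_smul]
    linarith
  have hgap0 : ∀ ω, 0 ≤ gap Y f (Z (k + 1) ω).1 (Z (k + 1) ω).2 := fun ω =>
    hf.gap_nonneg hμy _ (hmem (k + 1) ω)
  have hgap : ∀ ω, gap Y f (Z (k + 1) ω).1 (Z (k + 1) ω).2
      ≤ regGap Y f ρ (Z k ω).1 (Z (k + 1) ω).1 (Z (k + 1) ω).2
        + (2 + 4 * (ρ / μx)) * (regGap Y f ρ (Z k ω).1 (Z k ω).1 (Z k ω).2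
          + regGap Y f ρ (Z k ω).1 (Z (k + 1) ω).1 (Z (k + 1) ω).2) := fun ω =>
    hf.gap_le hρ hμy hμx _ _ (hmem (k + 1) ω) (hmem k ω)
  have hbi := (hGi k).add (((hDi k).add (hGi k)).const_mul (2 + 4 * (ρ / μx)))
  have hint : Integrable (fun ω => gap Y f (Z (k + 1) ω).1 (Z (k + 1) ω).2) Pr :=
    hbi.mono' ((hZk (k + 1)).2.measurable_gap hf).aestronglyMeasurable
      (Filter.Eventually.of_forall fun ω => by
        rw [Real.norm_of_nonneg (hgap0 ω)]; exact hgap ω)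
  refine ⟨hint, ?_⟩
  have h6 := integral_mono hint hbi hgap
  rw [integral_add' (hGi k) (((hDi k).add (hGi k)).const_mul (2 + 4 * (ρ / μx))),
    integral_const_mul, integral_add' (hDi k) (hGi k)] at h6
  refine h6.trans ?_
  change G k + (2 + 4 * (ρ / μx)) * (D k + G k) ≤ _
  have h7 : G k + (2 + 4 * (ρ / μx)) * (D k + G k) ≤ 5 * (ρ / μx + 1) * (D k + G k) := by
    nlinarith [mul_nonneg hκ (add_nonneg (hD0 k) (hG0 k)), hD0 k, hG0 k]
  set e := Real.exp (-rate L ρ μ * k) with he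
  have he0 : 0 < e := Real.exp_pos _
  have h8 : D k + G k ≤ e * (20000 / 3 * (ε₀ + σ ^ 2 / ℓ * (k + 1))) := by
    have h9 := mul_le_mul_of_nonneg_left hinit he0.le
    have h10 : 0 ≤ e * S := by positivity
    have h11 := mul_le_mul_of_nonneg_left hSle he0.le
    have h12 : 0 ≤ e * S * k := by positivity
    have h13 := mul_le_mul_of_nonneg_right h11 (Nat.cast_nonneg k : (0 : ℝ) ≤ k)
    have h14 : 0 ≤ e * ε₀ := by positivity
    linarith [h4 k]
  have h9 : e ≤ 3 * Real.exp (-rate L ρ μ * (k + 1 : ℕ)) := by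
    have h10 : e = Real.exp (rate L ρ μ) * Real.exp (-rate L ρ μ * (k + 1 : ℕ)) := by
      rw [he, ← Real.exp_add]; push_cast; ring_nf
    rw [h10]
    gcongr
    exact exp_rate_le hρ hL hμ
  have h10 : 0 ≤ 20000 / 3 * (ε₀ + σ ^ 2 / ℓ * (k + 1)) := by positivity
  calc _ ≤ 5 * (ρ / μx + 1) * (D k + G k) := h7
    _ ≤ 5 * (ρ / μx + 1) * ((3 * Real.exp (-rate L ρ μ * (k + 1 : ℕ)))
        * (20000 / 3 * (ε₀ + σ ^ 2 / ℓ * (k + 1)))) := by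
      gcongr
      exact h8.trans (mul_le_mul_of_nonneg_right h9 h10)
    _ = _ := by push_cast; ring

end Convergence

end

/-! ### The number of stages and its cost -/

section

section Complexity

variable {ℓ L ρ μ μx μy σ ε₀ ε : ℝ}

theorem complexity_nonneg (hρ : 0 < ρ) (hμx : 0 < μx) (hμy : 0 < μy) (hε : 0 < ε) :
    0 ≤ complexity ℓ L ρ μ μx μy σ ε₀ ε := by
  have hm : 0 < min ρ μy := lt_min hρ hμy
  exact mul_nonneg (by positivity) (le_max_of_le_right (by positivity))

/-- This is where the number of stages is compared with the condition number `(L + ρ) / μ`. -/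
theorem inv_rate_le (hρ : 0 < ρ) (hL : 0 ≤ L) (hμ : 0 < μ) (hμL : μ ≤ L + 2 * ρ) :
    1 / rate L ρ μ ≤ 9 * ((L + ρ) / μ) := by
  rw [rate, one_div_div, ← mul_div_assoc, div_le_div_iff₀ (by positivity) hμ, cConst]
  nlinarith

/-- The total length of the first `K` epochs, as a geometric sum. -/
theorem sum_epochLength_le (hρ : 0 < ρ) (hρℓ : ρ ≤ ℓ) (hL : 0 ≤ L) (hμ : 0 < μ) (hμy : 0 < μy)
    (K : ℕ) :
    ((∑ k ∈ Finset.Icc 1 K, epochLength (1 / 16 / ℓ) L ρ μ μy k : ℕ) : ℝ)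
      ≤ 3393 * (ℓ / (min ρ μy * rate L ρ μ)) * Real.exp (rate L ρ μ * K) := by
  have hm : 0 < min ρ μy := lt_min hρ hμy
  have hα := rate_pos hρ hL hμ
  have hℓ : 0 < ℓ := by linarith
  have hℓm : 1 ≤ ℓ / min ρ μy := by
    rw [one_le_div hm]; exact (min_le_left _ _).trans hρℓ
  rw [sum_Icc_one_eq_sum_range]
  induction K with
  | zero => simp; positivity
  | succ K ih =>
    rw [Finset.sum_range_succ, Nat.cast_add, epochLength_succ]
    set α := rate L ρ μ
    have h0 : 1 ≤ Real.exp (α * K) := Real.one_le_exp (by positivity)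
    have h1 : (⌈212 / (1 / 16 / ℓ * min ρ μy) * Real.exp (α * K)⌉₊ : ℝ)
        ≤ 3393 * (ℓ / min ρ μy) * Real.exp (α * K) := by
      refine (Nat.ceil_lt_add_one (by positivity)).le.trans ?_
      have h2 : 212 / (1 / 16 / ℓ * min ρ μy) = 3392 * (ℓ / min ρ μy) := by
        field_simp; norm_num
      rw [h2]
      nlinarith
    -- `α ≤ exp α - 1`
    have h2 : Real.exp (α * K) * α ≤ Real.exp (α * (K + 1 : ℕ)) - Real.exp (α * K) := by
      have h3 : Real.exp (α * (K + 1 : ℕ)) = Real.exp (α * K) * Real.exp α := by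
        rw [← Real.exp_add]; push_cast; ring_nf
      rw [h3]
      nlinarith [Real.add_one_le_exp α, Real.exp_pos (α * K)]
    have h3 : 3393 * (ℓ / min ρ μy) * Real.exp (α * K)
        = 3393 * (ℓ / (min ρ μy * α)) * (Real.exp (α * K) * α) := by
      field_simp
    have h4 : 0 ≤ 3393 * (ℓ / (min ρ μy * α)) := by positivity
    have h5 := mul_le_mul_of_nonneg_left h2 h4
    rw [← h3] at h5
    linarith

/-- With `y = 4 q (1 + log q)`, the function `q (1 + x) exp (-x)` is at most `1` for
`x ≥ log y`. -/
theorem mul_one_add_le_exp {q x : ℝ} (hq : 1 ≤ q)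
    (hx : Real.log (4 * q * (1 + Real.log q)) ≤ x) : q * (1 + x) ≤ Real.exp x := by
  have hl : 0 ≤ Real.log q := Real.log_nonneg hq
  set x₀ := Real.log (4 * q * (1 + Real.log q)) with hx₀
  have h1 : x₀ = Real.log 4 + Real.log q + Real.log (1 + Real.log q) := by
    rw [hx₀, Real.log_mul (by positivity) (by positivity), Real.log_mul (by norm_num) (by positivity)]
  have h2 := Real.log_le_sub_one_of_pos (by norm_num : (0 : ℝ) < 4)
  have h3 := Real.log_le_sub_one_of_pos (by positivity : 0 < 1 + Real.log q)
  have h4 : 0 ≤ x₀ := Real.log_nonneg (by nlinarith)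
  have h5 : Real.exp x₀ = 4 * q * (1 + Real.log q) := Real.exp_log (by positivity)
  have h6 : q * (1 + x₀) ≤ Real.exp x₀ := by
    rw [h5, mul_comm (4 : ℝ), mul_assoc]
    exact mul_le_mul_of_nonneg_left (by linarith) (by positivity)
  have h7 : 1 + x ≤ (1 + x₀) * Real.exp (x - x₀) := by
    have h8 := Real.add_one_le_exp (x - x₀)
    nlinarith [mul_nonneg h4 (sub_nonneg.2 hx)]
  calc q * (1 + x) ≤ q * ((1 + x₀) * Real.exp (x - x₀)) := by gcongr
    _ = q * (1 + x₀) * Real.exp (x - x₀) := by ring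
    _ ≤ Real.exp x₀ * Real.exp (x - x₀) := by gcongr
    _ = Real.exp x := by rw [← Real.exp_add]; ring_nf

/-- The logarithmic factor in the cost is bounded by `log (2 + M)`, since `Q ≤ 81 M`. -/
theorem cost_le {a q Q M : ℝ} (ha : 1 ≤ a) (hq : 0 < q)
    (hQM : a * Q ≤ 81 * M) (hqQ : q = 10 ^ 5 * Q) :
    3393 * a * (12 * q * (1 + Real.log q)) ≤ 2 * 10 ^ 13 * M * Real.log (2 + M) := by
  have hQ : 0 < Q := by linarith
  have hQa : Q ≤ a * Q := le_mul_of_one_le_left hQ.le ha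
  have h3 : q ≤ 81 * 10 ^ 5 * M := by linarith
  have hM : 0 < M := by linarith
  have hlog2 : 1 / 2 ≤ Real.log (2 + M) := by
    have h1 := Real.log_le_log (by norm_num) (by linarith : (2 : ℝ) ≤ 2 + M)
    linarith [Real.log_two_gt_d9]
  have h4 : Real.log q ≤ 20 + Real.log (2 + M) := by
    have h6 : (81 * 10 ^ 5 : ℝ) ≤ Real.exp 20 := by
      have h7 : Real.exp 20 = Real.exp 1 ^ 20 := by rw [← Real.exp_nat_mul]; norm_num
      rw [h7]
      calc (81 * 10 ^ 5 : ℝ) ≤ 2.7 ^ 20 := by norm_num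
        _ ≤ _ := by gcongr; linarith [Real.exp_one_gt_d9]
    have h5 : 81 * 10 ^ 5 * M ≤ Real.exp 20 * (2 + M) :=
      mul_le_mul h6 (by linarith) hM.le (Real.exp_pos _).le
    have h6 := Real.log_le_log hq (h3.trans h5)
    rwa [Real.log_mul (Real.exp_pos _).ne' (by positivity), Real.log_exp] at h6
  have h5 : 1 + Real.log q ≤ 43 * Real.log (2 + M) := by linarith
  calc 3393 * a * (12 * q * (1 + Real.log q))
      ≤ 3393 * a * (12 * q * (43 * Real.log (2 + M))) := by gcongr
    _ = 3393 * 12 * 10 ^ 5 * 43 * Real.log (2 + M) * (a * Q) := by rw [hqQ]; ring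
    _ ≤ 3393 * 12 * 10 ^ 5 * 43 * Real.log (2 + M) * (81 * M) := by gcongr
    _ ≤ 2 * 10 ^ 13 * M * Real.log (2 + M) := by
      have : 0 ≤ M * Real.log (2 + M) := by positivity
      linarith

/-- A number of stages that is sufficient for accuracy `ε`, and its cost. -/
theorem exists_stages (hρ : 0 < ρ) (hρℓ : ρ ≤ ℓ) (hL : 0 ≤ L) (hμ : 0 < μ) (hμx : 0 < μx)
    (hμy : 0 < μy) (hε₀ : 0 ≤ ε₀) (hε : 0 < ε) (hμL : μ ≤ L + 2 * ρ) :
    ∃ K₀ : ℕ,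
      ((∑ k ∈ Finset.Icc 1 K₀, epochLength (1 / 16 / ℓ) L ρ μ μy k : ℕ) : ℝ)
          ≤ 2 * 10 ^ 13 * complexity ℓ L ρ μ μx μy σ ε₀ ε
              * Real.log (2 + complexity ℓ L ρ μ μx μy σ ε₀ ε) ∧
      ∀ K : ℕ, K₀ ≤ K →
        10 ^ 5 * (ρ / μx + 1) * Real.exp (-rate L ρ μ * K) * (ε₀ + σ ^ 2 / ℓ * K) ≤ ε := by
  have hm : 0 < min ρ μy := lt_min hρ hμy
  have hα := rate_pos hρ hL hμ
  have hα1 := rate_le_one hρ hL hμ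
  have hα3 := exp_rate_le hρ hL hμ
  have hinv := inv_rate_le hρ hL hμ hμL
  have hℓ : 0 < ℓ := by linarith
  have hM0 : 0 ≤ complexity ℓ L ρ μ μx μy σ ε₀ ε :=
    complexity_nonneg hρ hμx hμy hε
  have hMdef : complexity ℓ L ρ μ μx μy σ ε₀ ε = (ρ / μx + 1) * max (ℓ * (L + ρ) * ε₀
    / (μ * min ρ μy * ε)) ((L + ρ) ^ 2 * σ ^ 2 / (μ ^ 2 * min ρ μy * ε)) := rfl
  have hcost := fun K => sum_epochLength_le hρ hρℓ hL hμ hμy K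
  have hmℓ : min ρ μy ≤ ℓ := (min_le_left _ _).trans hρℓ
  set M := complexity ℓ L ρ μ μx μy σ ε₀ ε
  set α := rate L ρ μ
  set m := min ρ μy
  set κ := ρ / μx + 1 with hκdef
  have hκ : 0 < κ := by positivity
  set β := (L + ρ) / μ with hβ
  have hβ0 : 0 < β := by positivity
  set a := ℓ / (m * α) with ha
  have ha1 : 1 ≤ a := by
    rw [ha, one_le_div (by positivity)]
    nlinarith
  set Q := max (κ * ε₀ / ε) (κ * σ ^ 2 / (ℓ * ε * α)) with hQ
  have hQ1 : κ * ε₀ ≤ Q * ε := (div_le_iff₀ hε).1 (le_max_left _ _)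
  have hQ2 : κ * σ ^ 2 ≤ Q * (ℓ * ε * α) := (div_le_iff₀ (by positivity)).1 (le_max_right _ _)
  have hQM : a * Q ≤ 81 * M := by
    rw [hQ, mul_max_of_nonneg _ _ (by positivity)]
    refine max_le ?_ ?_
    · calc a * (κ * ε₀ / ε) = κ * (ℓ * ε₀ / (m * ε)) * (1 / α) := by rw [ha]; field_simp
        _ ≤ κ * (ℓ * ε₀ / (m * ε)) * (9 * β) := by gcongr
        _ = 9 * (κ * (ℓ * (L + ρ) * ε₀ / (μ * m * ε))) := by rw [hβ]; field_simp
        _ ≤ 9 * M := by rw [hMdef]; gcongr; exact le_max_left _ _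
        _ ≤ 81 * M := by linarith
    · calc a * (κ * σ ^ 2 / (ℓ * ε * α)) = κ * (σ ^ 2 / (m * ε)) * (1 / α) ^ 2 := by
            rw [ha]; field_simp
        _ ≤ κ * (σ ^ 2 / (m * ε)) * (9 * β) ^ 2 := by gcongr
        _ = 81 * (κ * ((L + ρ) ^ 2 * σ ^ 2 / (μ ^ 2 * m * ε))) := by rw [hβ]; field_simp; norm_num
        _ ≤ 81 * M := by rw [hMdef]; gcongr; exact le_max_right _ _
  -- it suffices that `10⁵ Q (1 + α K) ≤ exp (α K)`
  have hsuff : ∀ K : ℕ, 10 ^ 5 * Q * (1 + α * K) ≤ Real.exp (α * K) →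
      10 ^ 5 * κ * Real.exp (-α * K) * (ε₀ + σ ^ 2 / ℓ * K) ≤ ε := fun K hK => by
    have h1 : κ * (ε₀ + σ ^ 2 / ℓ * K) ≤ Q * ε * (1 + α * K) := by
      have h2 : κ * (σ ^ 2 / ℓ) ≤ Q * ε * α := by
        rw [← mul_div_assoc, div_le_iff₀ hℓ]; linarith
      have h3 := mul_le_mul_of_nonneg_right h2 (Nat.cast_nonneg K : (0 : ℝ) ≤ K)
      linarith
    calc 10 ^ 5 * κ * Real.exp (-α * K) * (ε₀ + σ ^ 2 / ℓ * K)
        = 10 ^ 5 * Real.exp (-α * K) * (κ * (ε₀ + σ ^ 2 / ℓ * K)) := by ring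
      _ ≤ 10 ^ 5 * Real.exp (-α * K) * (Q * ε * (1 + α * K)) := by gcongr
      _ = ε * Real.exp (-α * K) * (10 ^ 5 * Q * (1 + α * K)) := by ring
      _ ≤ ε * Real.exp (-α * K) * Real.exp (α * K) := by gcongr
      _ = ε := by rw [mul_assoc, ← Real.exp_add]; simp
  have hlog2 : 1 / 2 ≤ Real.log (2 + M) := by
    have h1 := Real.log_le_log (by norm_num) (by linarith : (2 : ℝ) ≤ 2 + M)
    linarith [Real.log_two_gt_d9]
  rcases le_or_gt (10 ^ 5 * Q) 1 with hq | hq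
  · -- the starting point and all later iterates are accurate enough
    refine ⟨0, by simp; positivity, fun K _ => hsuff K ?_⟩
    have h1 := Real.add_one_le_exp (α * K)
    have h2 : 0 ≤ 1 + α * K := by positivity
    nlinarith
  set q := 10 ^ 5 * Q with hqdef
  have hq0 : 0 < q := by linarith
  have hlq : 0 ≤ Real.log q := Real.log_nonneg hq.le
  set x₀ := Real.log (4 * q * (1 + Real.log q)) with hx₀
  have hx₀0 : 0 ≤ x₀ := Real.log_nonneg (by nlinarith)
  have hceil := Nat.le_ceil (x₀ / α)
  rw [div_le_iff₀ hα] at hceil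
  refine ⟨⌈x₀ / α⌉₊, (hcost _).trans ?_, fun K hK => hsuff K (mul_one_add_le_exp hq.le ?_)⟩
  · have h1 : α * (⌈x₀ / α⌉₊ : ℝ) ≤ x₀ + α := by
      have h2 := mul_le_mul_of_nonneg_left (Nat.ceil_lt_add_one (div_nonneg hx₀0 hα.le)).le hα.le
      rwa [mul_add, mul_div_cancel₀ _ hα.ne', mul_one] at h2
    have h2 : Real.exp (α * (⌈x₀ / α⌉₊ : ℝ)) ≤ 12 * q * (1 + Real.log q) := by
      calc Real.exp (α * (⌈x₀ / α⌉₊ : ℝ)) ≤ Real.exp (x₀ + α) := Real.exp_le_exp.2 h1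
        _ = 4 * q * (1 + Real.log q) * Real.exp α := by
          rw [Real.exp_add, hx₀, Real.exp_log (by positivity)]
        _ ≤ 4 * q * (1 + Real.log q) * 3 := by gcongr
        _ = _ := by ring
    calc 3393 * a * Real.exp (α * (⌈x₀ / α⌉₊ : ℝ))
        ≤ 3393 * a * (12 * q * (1 + Real.log q)) := by gcongr
      _ ≤ _ := cost_le ha1 hq0 hQM hqdef
  · have h1 : (⌈x₀ / α⌉₊ : ℝ) ≤ K := by exact_mod_cast hK
    nlinarith

end Complexity

end

end PES

end

theorem corollary1 :
    -- universal constants: step-size factor, and constant and exponent of the soft-O bound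
    ∃ (θ C : ℝ) (p : ℕ), 0 < θ ∧ θ ≤ 1 / (2 * Real.sqrt 2) ∧ 0 < C ∧
    ∀ (ℓ L ρ μ μx μy σ ε₀ ε : ℝ),
      0 < ρ → ρ ≤ ℓ → 0 ≤ L → 0 < μ → 0 < μx → 0 < μy → 0 ≤ σ → 0 ≤ ε₀ → 0 < ε →
    -- a sufficient number of stages, which depends on the parameters only
    ∃ K₀ : ℕ,
      ((∑ k ∈ Finset.Icc 1 K₀, PES.epochLength (θ / ℓ) L ρ μ μy k : ℕ) : ℝ)
          ≤ C * PES.complexity ℓ L ρ μ μx μy σ ε₀ ε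
              * Real.log (2 + PES.complexity ℓ L ρ μ μx μy σ ε₀ ε) ^ p ∧
      ∀ (d d' : ℕ) (Y : Set (PES.E d')) (f : PES.E d → PES.E d' → ℝ)
        (gy : PES.E d → PES.E d' → PES.E d'),
        PES.IsMinMaxProblem Y f gy ℓ L ρ μ μx μy →
      ∀ (Ξ : Type*) [MeasurableSpace Ξ] (ν : Measure Ξ) [IsProbabilityMeasure ν]
        (Gx : PES.E d → PES.E d' → Ξ → PES.E d) (Gy : PES.E d → PES.E d' → Ξ → PES.E d'),
        PES.IsStochGrad Y f gy ν Gx Gy σ →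
      ∀ (Ω : Type*) [MeasurableSpace Ω] (Pr : Measure Ω) [IsProbabilityMeasure Pr]
        (ξ : ℕ → ℕ → Ω → Ξ),
        (∀ k t, Measurable (ξ k t)) → (∀ k t, Measure.map (ξ k t) Pr = ν) →
        iIndepFun (fun i : ℕ × ℕ => ξ i.1 i.2) Pr →
      ∀ (x₀ : PES.E d) (y₀ : PES.E d'), y₀ ∈ Y → PES.gap Y f x₀ y₀ ≤ ε₀ →
      ∀ K : ℕ, K₀ ≤ K →
        Integrable (fun ω =>
            PES.gap Y f (PES.iterate Y Gx Gy ξ (θ / ℓ) L ρ μ μy (x₀, y₀) K ω).1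
              (PES.iterate Y Gx Gy ξ (θ / ℓ) L ρ μ μy (x₀, y₀) K ω).2) Pr ∧
          ∫ ω, PES.gap Y f (PES.iterate Y Gx Gy ξ (θ / ℓ) L ρ μ μy (x₀, y₀) K ω).1
              (PES.iterate Y Gx Gy ξ (θ / ℓ) L ρ μ μy (x₀, y₀) K ω).2 ∂Pr ≤ ε := by
  refine ⟨1 / 16, 2 * 10 ^ 13, 1, by norm_num, ?_, by norm_num, ?_⟩
  · rw [div_le_div_iff₀ (by norm_num) (by positivity)]
    have h : Real.sqrt 2 ≤ 2 := Real.sqrt_le_iff.2 (by norm_num)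
    linarith
  intro ℓ L ρ μ μx μy σ ε₀ ε hρ hρℓ hL hμ hμx hμy _ hε₀ hε
  simp only [pow_one]
  by_cases hμL : μ ≤ L + 2 * ρ
  · obtain ⟨K₀, hcost, hK₀⟩ :=
      PES.exists_stages (σ := σ) hρ hρℓ hL hμ hμx hμy hε₀ hε hμL
    refine ⟨K₀, hcost, ?_⟩
    intro d d' Y f gy hf Ξ _ ν _ Gx Gy hG Ω _ Pr _ ξ hξ hν hind x₀ y₀ hy₀ hgap K hK
    obtain ⟨hint, hle⟩ := PES.integral_gap_iterate_le (z₀ := (x₀, y₀)) hf hρ hρℓ hL hμ hμx hμy hG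
      hξ hν hind hy₀ hgap K rfl
    exact ⟨hint, hle.trans (hK₀ K hK)⟩
  · -- there is no such problem for this `μ`
    have hM : 0 ≤ PES.complexity ℓ L ρ μ μx μy σ ε₀ ε :=
      PES.complexity_nonneg hρ hμx hμy hε
    refine ⟨0, ?_, fun d d' Y f gy hf => absurd (hf.mu_le hρ hL) hμL⟩
    have : 0 ≤ Real.log (2 + PES.complexity ℓ L ρ μ μx μy σ ε₀ ε) :=
      Real.log_nonneg (by linarith)
    simp only [Finset.Icc_eq_empty_of_lt zero_lt_one, Finset.sum_empty, Nat.cast_zero]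
    positivity
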